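/- Let $k$ be a field of characteristic zero and $H$ a Hopf algebra over $k$ with coproduct $\Delta(h)=h_1\otimes h_2$, counit $\varepsilon$ and bijective antipode $S$. A left $H$-category is a small $k$-linear category $\mathcal D$ whose morphism spaces are left $H$-modules with $h(\mathrm{id}_X)=\varepsilon(h)\mathrm{id}_X$ and $h(gf)=(h_1g)(h_2f)$. A right-left SAYD module over $H$ is a right $H$-module $M$ with a left $H$-coaction $m\mapsto m_{(-1)}\otimes m_{(0)}$ such that $(mh)_{(-1)}\otimes (mh)_{(0)}=S(h_3)m_{(-1)}h_1\otimes m_{(0)}h_2$ and $m_{(0)}m_{(-1)}=m$. Let $\mathcal D$ be a left $H$-category, $M$ a right-left SAYD module and $n\ge 0$. Put $$CN_n(\mathcal D)=\bigoplus_{X_0,\dots,X_n}\mathrm{Hom}(X_1,X_0)\otimes \mathrm{Hom}(X_2,X_1)\otimes\cdots\otimes \mathrm{Hom}(X_0,X_n).$$ Let $C^n_H(\mathcal D,M)$ be the space of $k$-linear maps $\phi:M\otimes CN_n(\mathcal D)\to k$ with $\phi(mh_1\otimes S(h_2)x)=\varepsilon(h)\phi(m\otimes x)$, where $H$ acts diagonally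 on $CN_n(\mathcal D)$. Let $Z^n_H(\mathcal D,M)$ be the space of those $\phi\in C^n_H(\mathcal D,M)$ with $b\phi=0$ and $\phi=(-1)^n\tau_n\phi$, where $$(\tau_n\phi)(m\otimes f^0\otimes\cdots\otimes f^n)=\phi(m_{(0)}\otimes S^{-1}(m_{(-1)})f^n\otimes f^0\otimes\cdots\otimes f^{n-1}),$$ $$(b\phi)(m\otimes f^0\otimes\cdots\otimes f^{n+1})=\sum_{i=0}^{n}(-1)^i\phi(m\otimes f^0\otimes\cdots\otimes f^if^{i+1}\otimes\cdots\otimes f^{n+1})+(-1)^{n+1}\phi(m_{(0)}\otimes (S^{-1}(m_{(-1)})f^{n+1})f^0\otimes f^1\otimes\cdots\otimes f^{n}).$$ A semicategory is a category without the requirement of identities. A DGH-semicategory is a small $k$-linear semicategory $\mathcal S$ whose morphism spaces are cochain complexes $(\mathrm{Hom}^r(X,Y),\hat\partial)_{r\ge0}$ of left $H$-modules (with $\hat\partial$ $H$-linear), such that $\hat\partial(gf)=\hat\partial(g)f+(-1)^{\deg g}g\,\hat\partial(f)$ and $h(gf)=(h_1g)(h_2f)$; $\mathcal S^0$ denotes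 its degree-zero part. A closed graded $(H,M)$-trace of dimension $n$ on $\mathcal S$ is a family of $k$-linear maps $T_X:M\otimes \mathrm{Hom}^n(X,X)\to k$ with $T_X(mh_1\otimes S(h_2)f)=\varepsilon(h)T_X(m\otimes f)$, $T_X(m\otimes\hat\partial f')=0$, and $T_X(m\otimes g'g)=(-1)^{ij}T_Y(m_{(0)}\otimes(S^{-1}(m_{(-1)})g)g')$ for $g\in\mathrm{Hom}^i(X,Y)$, $g'\in \mathrm{Hom}^j(Y,X)$, $i+j=n$. An $n$-dimensional cycle over $\mathcal D$ consists of a DGH-semicategory $\mathcal S$ such that $\mathcal S^0$ is a left $H$-category, a closed graded $(H,M)$-trace $T$ of dimension $n$ on $\mathcal S$, and an $H$-linear semifunctor $\rho:\mathcal D\to\mathcal S^0$ (identities need not be preserved). The DGH-semicategory $\Omega(\mathcal D)$ has the objects of $\mathcal D$. Its degree $r$ morphisms $X\to Y$ are the sums of symbols $(f^0+\mu)\,df^1\cdots df^r$, that is, the elements of $\bigoplus_{X_1,\dots,X_r}\mathrm{Hom}_{\tilde{\mathcal D}}(X_1,Y)\otimes\mathrm{Hom}_{\mathcal D}(X_2,X_1)\otimes\cdots\otimes\mathrm{Hom}_{\mathcal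 D}(X,X_r)$, where $\tilde{\mathcal D}$ is $\mathcal D$ with new identities $\tilde 1_X$ adjoined. Further, $\partial((f^0+\mu)df^1\cdots df^r)=\tilde 1\,df^0df^1\cdots df^r$, $h((f^0+\mu)df^1\cdots df^r)=(h_1f^0+\varepsilon(h_1)\mu)d(h_2f^1)\cdots d(h_{r+1}f^r)$, and the composition is $$((f^0+\mu)df^1\cdots df^r)((f^{r+1}+\mu')df^{r+2}\cdots df^s)=\sum_{j=1}^r(-1)^{r-j}(f^0+\mu)df^1\cdots d(f^jf^{j+1})\cdots df^s+(-1)^r(f^0+\mu)f^1df^2\cdots df^s+\mu'(f^0+\mu)df^1\cdots df^rdf^{r+2}\cdots df^s.$$ **Theorem.** (A) For $\phi\in C^n_H(\mathcal D,M)$ the following are equivalent. 1. $\phi$ is the character of an $n$-dimensional cycle $(\mathcal S,\hat\partial,T,\rho)$ over $\mathcal D$, i.e. $\phi(m\otimes f^0\otimes\cdots\otimes f^n)=T_{\rho(X_0)}\big(m\otimes\rho(f^0)\hat\partial(\rho(f^1))\cdots\hat\partial(\rho(f^n))\big)$ for all $m\in M$ and all $f^0\otimes\cdots\otimes f^n\in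 \mathrm{Hom}(X_1,X_0)\otimes\cdots\otimes \mathrm{Hom}(X_0,X_n)$. 2. There is a closed graded $(H,M)$-trace $T$ of dimension $n$ on $\Omega(\mathcal D)$ with $\phi(m\otimes f^0\otimes\cdots\otimes f^n)=T_{X_0}(m\otimes f^0df^1\cdots df^n)$ for all such $m$ and $f^0,\dots,f^n$. 3. $\phi\in Z^n_H(\mathcal D,M)$. (B) If $n\ge1$, then sending $T$ to the map $m\otimes f^0\otimes\cdots\otimes f^n\mapsto T_{X_0}(m\otimes f^0df^1\cdots df^n)$ is a bijection from the closed graded $(H,M)$-traces of dimension $n$ on $\Omega(\mathcal D)$ onto $Z^n_H(\mathcal D,M)$. For $n=0$ the same rule is a bijection from the closed graded $(H,M)$-traces $T$ of dimension $0$ with $T_X(m\otimes\tilde 1_X)=0$ for all $X$ and $m$ onto $Z^0_H(\mathcal D,M)$. (C) The ordinary case ($H=k=M$) holds for every small $k$-linear category $\mathcal C$ and every $k$-linear map $\phi:CN_n(\mathcal C)\to k$. It concerns DG-semicategories $\mathcal S$ with $\mathcal S^0$ a category, $k$-linear semifunctors $\mathcal C\to\mathcal S^0$, closed graded traces $T_X:\mathrm{Hom}^n(X,X)\to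 k$ (so $T_X(\hat\partial f)=0$ and $T_X(g'g)=(-1)^{ij}T_Y(gg')$), and the space $Z^n(\mathcal C)$ of ordinary cyclic cocycles, i.e. those $\phi$ with $b\phi=0$ and $\phi=(-1)^n\tau_n\phi$. Then the equivalence of 1, 2 and 3, and the bijections in (B), hold with $M$ and the $H$-actions and coactions omitted. -/

import Mathlib

open CategoryTheory TensorProduct DirectSum

universe u v w

noncomputable section

namespace HopfCyclic

/-! ### Hopf algebras, diagonal actions, stable anti-Yetter-Drinfeld modules

A left `H`-module structure on a `k`-vector space `V` (compatible with the scalars) is recorded as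
a homomorphism of `k`-algebras `H →ₐ[k] Module.End k V`; right `H`-modules are modules over the
opposite algebra `Hᵐᵒᵖ`, as usual in Mathlib. -/

section Hopf

variable (k : Type u) [Field k] (H : Type v) [Ring H] [HopfAlgebra k H]

/-- The antipode of `H` is bijective. -/
class BijectiveAntipode : Prop where
  bijective : Function.Bijective (HopfAlgebra.antipode k : H →ₗ[k] H)

/-- The inverse `S⁻¹` of the antipode. -/
def antipodeInv [BijectiveAntipode k H] : H →ₗ[k] H :=
  (LinearEquiv.ofBijective (HopfAlgebra.antipode k : H →ₗ[k] H)
    BijectiveAntipode.bijective).symm.toLinearMap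

/-- The map `End V ⊗ End W → End (V ⊗ W)`. -/
def tensEnd (V W : Type*) [AddCommGroup V] [Module k V] [AddCommGroup W] [Module k W] :
    Module.End k V ⊗[k] Module.End k W →ₗ[k] Module.End k (V ⊗[k] W) :=
  (Module.endTensorEndAlgHom (R := k) (S := k) (A := k)).toLinearMap

variable {k H}

/-- The diagonal action `h (v ⊗ w) = h₁ v ⊗ h₂ w`. -/
def tensAct {V W : Type*} [AddCommGroup V] [Module k V] [AddCommGroup W] [Module k W]
    (α : H →ₐ[k] Module.End k V) (β : H →ₐ[k] Module.End k W) :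
    H →ₐ[k] Module.End k (V ⊗[k] W) :=
  Module.endTensorEndAlgHom.comp
    ((Algebra.TensorProduct.map α β).comp (Bialgebra.comulAlgHom k H))

/-- The trivial action `h v = ε(h) v`. -/
def trivAct (V : Type*) [AddCommGroup V] [Module k V] : H →ₐ[k] Module.End k V :=
  (Algebra.ofId k (Module.End k V)).comp (Bialgebra.counitAlgHom k H)

/-- The componentwise action on a direct sum. -/
def sumAct {ι : Type*} {V : ι → Type*} [∀ i, AddCommGroup (V i)] [∀ i, Module k (V i)]
    (α : ∀ i, H →ₐ[k] Module.End k (V i)) : H →ₐ[k] Module.End k (⨁ i, V i) :=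
  AlgHom.ofLinearMap
    { toFun := fun h => DirectSum.lmap fun i => α i h
      map_add' := fun a b => by
        refine LinearMap.ext fun x => DFinsupp.ext fun i => ?_
        change α i (a + b) (x i) = α i a (x i) + α i b (x i)
        simp
      map_smul' := fun c a => by
        refine LinearMap.ext fun x => DFinsupp.ext fun i => ?_
        change α i (c • a) (x i) = c • α i a (x i)
        simp }
    (by
      refine LinearMap.ext fun x => DFinsupp.ext fun i => ?_
      change α i 1 (x i) = x i
      simp)
    (fun a b => by
      refine LinearMap.ext fun x => DFinsupp.ext fun i => ?_
      change α i (a * b) (x i) = α i a (α i b (x i))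
      simp)

theorem tensAct_tmul {V W : Type*} [AddCommGroup V] [Module k V] [AddCommGroup W] [Module k W]
    (α : H →ₐ[k] Module.End k V) (β : H →ₐ[k] Module.End k W) (h : H) (v : V) (w : W) :
    tensAct α β h (v ⊗ₜ[k] w) = ∑ i ∈ (Coalgebra.Repr.arbitrary k h).index,
      α ((Coalgebra.Repr.arbitrary k h).left i) v ⊗ₜ[k]
        β ((Coalgebra.Repr.arbitrary k h).right i) w := by
  change (Module.endTensorEndAlgHom (R := k) (S := k) (A := k)
    (Algebra.TensorProduct.map α β (Coalgebra.comul h))) (v ⊗ₜ[k] w) = _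
  conv_lhs => rw [← (Coalgebra.Repr.arbitrary k h).eq]
  simp only [map_sum, LinearMap.sum_apply]
  rfl

theorem sum_act_coassoc {V W U N : Type*} [AddCommGroup V] [Module k V] [AddCommGroup W]
    [Module k W] [AddCommGroup U] [Module k U] [AddCommGroup N] [Module k N]
    (α : H →ₐ[k] Module.End k V) (β : H →ₐ[k] Module.End k W) (γ : H →ₐ[k] Module.End k U)
    (T : V →ₗ[k] W →ₗ[k] U →ₗ[k] N) (h : H) (x : V) (y : W) (z : U) :
    ∑ i ∈ (Coalgebra.Repr.arbitrary k h).index,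
      ∑ j ∈ (Coalgebra.Repr.arbitrary k ((Coalgebra.Repr.arbitrary k h).left i)).index,
        T (α ((Coalgebra.Repr.arbitrary k ((Coalgebra.Repr.arbitrary k h).left i)).left j) x)
          (β ((Coalgebra.Repr.arbitrary k ((Coalgebra.Repr.arbitrary k h).left i)).right j) y)
          (γ ((Coalgebra.Repr.arbitrary k h).right i) z) =
    ∑ i ∈ (Coalgebra.Repr.arbitrary k h).index,
      ∑ j ∈ (Coalgebra.Repr.arbitrary k ((Coalgebra.Repr.arbitrary k h).right i)).index,
        T (α ((Coalgebra.Repr.arbitrary k h).left i) x)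
          (β ((Coalgebra.Repr.arbitrary k ((Coalgebra.Repr.arbitrary k h).right i)).left j) y)
          (γ ((Coalgebra.Repr.arbitrary k ((Coalgebra.Repr.arbitrary k h).right i)).right j) z) := by
  have key := Coalgebra.sum_tmul_tmul_eq (Coalgebra.Repr.arbitrary k h)
    (fun i => Coalgebra.Repr.arbitrary k ((Coalgebra.Repr.arbitrary k h).left i))
    (fun i => Coalgebra.Repr.arbitrary k ((Coalgebra.Repr.arbitrary k h).right i))
  have := congrArg (TensorProduct.lift (TensorProduct.uncurry (RingHom.id k) W U N ∘ₗ T) ∘ₗ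
    TensorProduct.map (α.toLinearMap.flip x)
      (TensorProduct.map (β.toLinearMap.flip y) (γ.toLinearMap.flip z))) key
  simpa [map_sum] using this

variable (k H)

/-- The right action of `H` on a right `H`-module `M`: `rightAct k H M h m = m h`. -/
def rightAct (M : Type w) [AddCommGroup M] [Module k M] [Module Hᵐᵒᵖ M]
    [IsScalarTower k Hᵐᵒᵖ M] : H →ₗ[k] Module.End k M :=
  (Algebra.lsmul k k M : Hᵐᵒᵖ →ₐ[k] Module.End k M).toLinearMap ∘ₗ
    (MulOpposite.opLinearEquiv k).toLinearMap

/-- The endomorphism `x ↦ S(c) x a` of `H`, linearly in `c` and in `a`. -/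
def antipodeConj : H →ₗ[k] H →ₗ[k] Module.End k H :=
  LinearMap.mk₂ k
    (fun c a => LinearMap.mulLeft k (HopfAlgebra.antipode k c) ∘ₗ LinearMap.mulRight k a)
    (fun _ _ _ => by ext; simp [add_mul]) (fun _ _ _ => by ext; simp)
    (fun _ _ _ => by ext; simp [mul_add]) (fun _ _ _ => by ext; simp)

/-- The map sending `a ⊗ (b ⊗ c)` to the endomorphism `x ⊗ m ↦ S(c) x a ⊗ m b` of `H ⊗ M`. -/
def aydMap (M : Type w) [AddCommGroup M] [Module k M] [Module Hᵐᵒᵖ M] [IsScalarTower k Hᵐᵒᵖ M] :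
    H ⊗[k] (H ⊗[k] H) →ₗ[k] Module.End k (H ⊗[k] M) :=
  tensEnd k H M ∘ₗ
    TensorProduct.map (TensorProduct.lift (antipodeConj k H)) (rightAct k H M) ∘ₗ
      (TensorProduct.comm k H (H ⊗[k] H)).toLinearMap ∘ₗ
        (TensorProduct.assoc k H H H).toLinearMap ∘ₗ
          (TensorProduct.comm k H (H ⊗[k] H)).toLinearMap

/-- A structure of right-left stable anti-Yetter-Drinfeld (SAYD) module over `H` on the right
`H`-module `M`: a left coaction `ρ(m) = m₍₋₁₎ ⊗ m₍₀₎` with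
`ρ(m h) = S(h₃) m₍₋₁₎ h₁ ⊗ m₍₀₎ h₂` and `m₍₀₎ m₍₋₁₎ = m`. -/
class SAYD (M : Type w) [AddCommGroup M] [Module k M] [Module Hᵐᵒᵖ M]
    [IsScalarTower k Hᵐᵒᵖ M] where
  coact : M →ₗ[k] H ⊗[k] M
  coassoc : ∀ m : M, TensorProduct.assoc k H H M (LinearMap.rTensor M Coalgebra.comul (coact m)) =
    LinearMap.lTensor H coact (coact m)
  counit : ∀ m : M, TensorProduct.lid k M (LinearMap.rTensor M Coalgebra.counit (coact m)) = m
  ayd : ∀ (m : M) (h : H), coact (rightAct k H M h m) =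
    aydMap k H M (LinearMap.lTensor H Coalgebra.comul (Coalgebra.comul (R := k) h)) (coact m)
  stable : ∀ m : M, TensorProduct.lift (rightAct k H M) (coact m) = m

section Coefficients

variable {k H}
variable (M : Type w) [AddCommGroup M] [Module k M] [Module Hᵐᵒᵖ M] [IsScalarTower k Hᵐᵒᵖ M]
variable {V : Type*} [AddCommGroup V] [Module k V] (α : H →ₐ[k] Module.End k V)

/-- The right action of `H` on `M ⊗ V`, `(m ⊗ v) h = m h₁ ⊗ S(h₂) v`. -/
def rightTensAct : H →ₗ[k] Module.End k (M ⊗[k] V) :=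
  tensEnd k M V ∘ₗ
    TensorProduct.map (rightAct k H M) (α.toLinearMap ∘ₗ HopfAlgebra.antipode k) ∘ₗ
      Coalgebra.comul

/-- The map `m ⊗ v ↦ m₍₀₎ ⊗ S⁻¹(m₍₋₁₎) v` on `M ⊗ V`. -/
def coactTwist [BijectiveAntipode k H] [SAYD k H M] : M ⊗[k] V →ₗ[k] M ⊗[k] V :=
  TensorProduct.lift
    (TensorProduct.lift
      (LinearMap.mk₂ k (fun (h : H) (m : M) => TensorProduct.mk k M V m ∘ₗ α (antipodeInv k H h))
        (fun _ _ _ => by ext; simp [TensorProduct.tmul_add])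
        (fun _ _ _ => by ext; simp)
        (fun _ _ _ => by ext; simp)
        (fun _ _ _ => by ext; simp [TensorProduct.smul_tmul'])) ∘ₗ
      SAYD.coact (k := k) (H := H))

end Coefficients

end Hopf

/-! ### Linear categories, `H`-categories and strings of morphisms -/

section Strings

variable (k : Type u) [Field k] {D : Type u} [SmallCategory D] [Preadditive D] [Linear k D]

/-- Composition `(g, f) ↦ g f` as a bilinear map. -/
def compMap (X Y Z : D) : (Y ⟶ Z) →ₗ[k] (X ⟶ Y) →ₗ[k] (X ⟶ Z) :=
  (Linear.comp (S := k) X Y Z).flip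

/-- A left `H`-category: the morphism spaces of the small `k`-linear category `D` are left
`H`-modules, `h(id) = ε(h) id` and `h(g f) = (h₁ g)(h₂ f)`. -/
class HCategory (k : Type u) [Field k] (H : Type v) [Ring H] [HopfAlgebra k H]
    (D : Type u) [SmallCategory D] [Preadditive D] [Linear k D] where
  act : ∀ X Y : D, H →ₐ[k] Module.End k (X ⟶ Y)
  act_id : ∀ (h : H) (X : D), act X X h (𝟙 X) = Coalgebra.counit (R := k) h • 𝟙 X
  act_comp : ∀ (h : H) {X Y Z : D} (g : Y ⟶ Z) (f : X ⟶ Y),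
    act X Z h (f ≫ g) =
      TensorProduct.lift (compMap k X Y Z) (tensAct (act Y Z) (act X Y) h (g ⊗ₜ[k] f))

/-- Given spaces `B X Y` for all objects `X, Y`, the space `strings k B n X Y` is
`⨁ B X₁ Y ⊗ Hom(X₂, X₁) ⊗ ⋯ ⊗ Hom(X, Xₙ)`, the sum over all `(X₁, …, Xₙ)` and the tensor products
bracketed to the left. For `n = 0` it is `B X Y`. -/
def strings (B : D → D → ModuleCat.{u} k) : ℕ → D → D → ModuleCat.{u} k
  | 0, X, Y => B X Y
  | n + 1, X, Y => ModuleCat.of k (⨁ W : D, (strings B n W Y ⊗[k] (X ⟶ W)))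

variable {k} {B : D → D → ModuleCat.{u} k}

open scoped Classical in
/-- Appending a morphism on the right: `(f⁰ ⊗ ⋯ ⊗ fⁿ, g) ↦ f⁰ ⊗ ⋯ ⊗ fⁿ ⊗ g`. -/
def append {n : ℕ} {X W Y : D} :
    strings k B n W Y →ₗ[k] (X ⟶ W) →ₗ[k] strings k B (n + 1) X Y :=
  (TensorProduct.mk k (strings k B n W Y) (X ⟶ W)).compr₂
    (DirectSum.lof k D (fun W : D => strings k B n W Y ⊗[k] (X ⟶ W)) W)

open scoped Classical in
/-- The linear map on strings of length `n + 1` that sends `f⁰ ⊗ ⋯ ⊗ fⁿ ⊗ g` to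
`φ W (f⁰ ⊗ ⋯ ⊗ fⁿ) g`, where `W` is the target of `g`. -/
def liftAppend {n : ℕ} {X Y : D} {N : Type*} [AddCommGroup N] [Module k N]
    (φ : ∀ W : D, strings k B n W Y →ₗ[k] (X ⟶ W) →ₗ[k] N) :
    strings k B (n + 1) X Y →ₗ[k] N :=
  DirectSum.toModule k D N fun W => TensorProduct.lift (φ W)

open scoped Classical in
@[simp]
theorem liftAppend_append {n : ℕ} {X W Y : D} {N : Type*} [AddCommGroup N] [Module k N]
    (φ : ∀ W : D, strings k B n W Y →ₗ[k] (X ⟶ W) →ₗ[k] N) (p : strings k B n W Y) (g : X ⟶ W) :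
    liftAppend φ (append p g) = φ W p g := by
  change DirectSum.toModule k D N (fun W => TensorProduct.lift (φ W))
    (DirectSum.lof k D (fun W : D => strings k B n W Y ⊗[k] (X ⟶ W)) W (p ⊗ₜ[k] g)) = φ W p g
  rw [DirectSum.toModule_lof, TensorProduct.lift.tmul]

theorem strings_induction {n : ℕ} {X Y : D} {P : strings k B (n + 1) X Y → Prop}
    (x : strings k B (n + 1) X Y) (zero : P 0) (add : ∀ x y, P x → P y → P (x + y))
    (app : ∀ (W : D) (p : strings k B n W Y) (g : X ⟶ W), P (append p g)) : P x := by
  classical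
  refine DirectSum.induction_on (β := fun W : D => strings k B n W Y ⊗[k] (X ⟶ W))
    (motive := P) x zero (fun W t => ?_) add
  induction t with
  | zero => rw [map_zero]; exact zero
  | add a b ha hb => rw [map_add]; exact add _ _ ha hb
  | tmul p g => exact app W p g

theorem strings_hom_ext {n : ℕ} {X Y : D} {N : Type*} [AddCommGroup N] [Module k N]
    {φ ψ : strings k B (n + 1) X Y →ₗ[k] N}
    (h : ∀ (W : D) (p : strings k B n W Y) (g : X ⟶ W), φ (append p g) = ψ (append p g)) :
    φ = ψ := by
  classical
  refine DirectSum.linearMap_ext (R := k) fun W => TensorProduct.ext' fun p g => ?_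
  exact h W p g

variable {H : Type v} [Ring H] [HopfAlgebra k H] [HCategory k H D]

/-- The diagonal action of `H` on strings. -/
def stringsAct (αB : ∀ X Y, H →ₐ[k] Module.End k (B X Y)) :
    ∀ (n : ℕ) (X Y : D), H →ₐ[k] Module.End k (strings k B n X Y)
  | 0, X, Y => αB X Y
  | n + 1, X, Y => sumAct fun W => tensAct (stringsAct αB n W Y) (HCategory.act X W)

end Strings

/-! ### The cyclic nerve and Hopf-cyclic cocycles -/

section CyclicNerve

variable (k : Type u) [Field k] {D : Type u} [SmallCategory D] [Preadditive D] [Linear k D]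

/-- The morphism spaces of `D`. -/
def homBase (X Y : D) : ModuleCat.{u} k := ModuleCat.of k (X ⟶ Y)

/-- `paths k n X Y = ⨁ Hom(X₁, Y) ⊗ Hom(X₂, X₁) ⊗ ⋯ ⊗ Hom(X, Xₙ)`. -/
abbrev paths (n : ℕ) (X Y : D) : Type u := strings k (homBase k) n X Y

/-- `(f⁰ ⊗ ⋯ ⊗ fⁿ, g) ↦ f⁰ ⊗ ⋯ ⊗ fⁿ g`. -/
def composeLast : ∀ (n : ℕ) {X W Y : D}, paths k n W Y →ₗ[k] (X ⟶ W) →ₗ[k] paths k n X Y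
  | 0, X, W, Y => compMap k X W Y
  | _ + 1, X, W, _ => liftAppend fun V =>
      LinearMap.mk₂ k (fun p f => append p ∘ₗ compMap k X W V f)
        (fun _ _ _ => by ext; simp) (fun _ _ _ => by ext; simp)
        (fun _ _ _ => by ext; simp) (fun _ _ _ => by ext; simp)

/-- `f⁰ ⊗ ⋯ ⊗ fⁿ⁺¹ ↦ f⁰ ⊗ ⋯ ⊗ fⁱ fⁱ⁺¹ ⊗ ⋯ ⊗ fⁿ⁺¹`, for `0 ≤ i ≤ n`. -/
def innerFace : ∀ (n _i : ℕ) {X Y : D}, paths k (n + 1) X Y →ₗ[k] paths k n X Y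
  | 0, _, _, _ => liftAppend fun _ => composeLast k 0
  | n + 1, i, _, _ =>
      if i = n + 1 then liftAppend fun _ => composeLast k (n + 1)
      else liftAppend fun _ => append ∘ₗ innerFace n i

/-- `(g, f⁰ ⊗ ⋯ ⊗ fⁿ) ↦ g f⁰ ⊗ ⋯ ⊗ fⁿ`. -/
def composeFirst : ∀ (n : ℕ) {X Y Z : D}, (Y ⟶ Z) →ₗ[k] paths k n X Y →ₗ[k] paths k n X Z
  | 0, X, Y, Z => compMap k X Y Z
  | n + 1, _, _, _ => LinearMap.flip <| liftAppend fun _ =>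
      LinearMap.mk₂ k (fun p f => append.flip f ∘ₗ (composeFirst n).flip p)
        (fun _ _ _ => by ext; simp) (fun _ _ _ => by ext; simp)
        (fun _ _ _ => by ext; simp) (fun _ _ _ => by ext; simp)

/-- `(g, f⁰ ⊗ ⋯ ⊗ fⁿ) ↦ g ⊗ f⁰ ⊗ ⋯ ⊗ fⁿ`. -/
def prepend : ∀ (n : ℕ) {X Y Z : D}, (Y ⟶ Z) →ₗ[k] paths k n X Y →ₗ[k] paths k (n + 1) X Z
  | 0, X, Y, Z => append (B := homBase k) (n := 0) (X := X) (W := Y) (Y := Z)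
  | n + 1, _, _, _ => LinearMap.flip <| liftAppend fun _ =>
      LinearMap.mk₂ k (fun p f => append.flip f ∘ₗ (prepend n).flip p)
        (fun _ _ _ => by ext; simp) (fun _ _ _ => by ext; simp)
        (fun _ _ _ => by ext; simp) (fun _ _ _ => by ext; simp)

variable (D) in
/-- The additive cyclic nerve
`CN_n = ⨁ Hom(X₁, X₀) ⊗ Hom(X₂, X₁) ⊗ ⋯ ⊗ Hom(X₀, Xₙ)`. -/
abbrev CN (n : ℕ) : Type u := ⨁ X : D, paths k n X X

open scoped Classical in
/-- The inclusion of the summand of loops at `X` in the cyclic nerve. -/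
def ofLoop (n : ℕ) (X : D) : paths k n X X →ₗ[k] CN k D n :=
  DirectSum.lof k D (fun X : D => paths k n X X) X

open scoped Classical in
/-- The face maps `d_i : CN_{n+1} → CN_n`; the last one is
`f⁰ ⊗ ⋯ ⊗ fⁿ⁺¹ ↦ fⁿ⁺¹ f⁰ ⊗ f¹ ⊗ ⋯ ⊗ fⁿ`. -/
def loopFace (n i : ℕ) : CN k D (n + 1) →ₗ[k] CN k D n :=
  if i ≤ n then DirectSum.lmap fun _ => innerFace k n i
  else DirectSum.toModule k D (CN k D n) fun _ => liftAppend fun W =>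
    ((composeFirst k n).compr₂ (ofLoop k n W)).flip

open scoped Classical in
/-- The cyclic operator `f⁰ ⊗ ⋯ ⊗ fⁿ ↦ fⁿ ⊗ f⁰ ⊗ ⋯ ⊗ fⁿ⁻¹` on the cyclic nerve. -/
def loopCyc : ∀ n : ℕ, CN k D n →ₗ[k] CN k D n
  | 0 => LinearMap.id
  | n + 1 =>
    DirectSum.toModule k D (CN k D (n + 1)) fun _ => liftAppend fun W =>
      ((prepend k n).compr₂ (ofLoop k (n + 1) W)).flip

variable (D) in
/-- The space `Zⁿ` of cyclic `n`-cocycles: `φ : CN_n → k` with `b φ = 0` and `φ = (-1)ⁿ τ φ`. -/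
def cyclicCocycles (n : ℕ) : Submodule k (CN k D n →ₗ[k] k) :=
  LinearMap.ker (∑ i ∈ Finset.range (n + 2), (-1 : k) ^ i • LinearMap.lcomp k k (loopFace k n i)) ⊓
    LinearMap.ker (LinearMap.id - (-1 : k) ^ n • LinearMap.lcomp k k (loopCyc k n))

variable (H : Type v) [Ring H] [HopfAlgebra k H] [HCategory k H D]

/-- The diagonal action of `H` on the cyclic nerve. -/
def loopAct (n : ℕ) : H →ₐ[k] Module.End k (CN k D n) :=
  sumAct fun X => stringsAct (B := homBase k) HCategory.act n X X

variable (M : Type w) [AddCommGroup M] [Module k M] [Module Hᵐᵒᵖ M] [IsScalarTower k Hᵐᵒᵖ M]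

variable (D) in
/-- The space `Cⁿ_H(D, M)` of right `H`-linear maps `M ⊗ CN_n → k`: those with
`φ(m h₁ ⊗ S(h₂) x) = ε(h) φ(m ⊗ x)`. -/
def cochains (n : ℕ) : Submodule k (M ⊗[k] CN k D n →ₗ[k] k) :=
  ⨅ h : H, LinearMap.ker (LinearMap.lcomp k k (rightTensAct M (loopAct k (D := D) H n) h) -
    Coalgebra.counit (R := k) h • LinearMap.id)

variable [BijectiveAntipode k H] [SAYD k H M]

open scoped Classical in
/-- For bilinear maps `β X W : Hom(X, W) × paths k n W X → N`, the map
`m ⊗ (f⁰ ⊗ ⋯ ⊗ fⁿ⁺¹) ↦ m₍₀₎ ⊗ β (S⁻¹(m₍₋₁₎) fⁿ⁺¹) (f⁰ ⊗ ⋯ ⊗ fⁿ)`. -/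
def rotate {n : ℕ} {N : Type*} [AddCommGroup N] [Module k N]
    (β : ∀ X W : D, (X ⟶ W) →ₗ[k] paths k n W X →ₗ[k] N) :
    M ⊗[k] CN k D (n + 1) →ₗ[k] M ⊗[k] N :=
  TensorProduct.lift <| LinearMap.flip <|
    DirectSum.toModule k D (M →ₗ[k] M ⊗[k] N) fun X => liftAppend fun W =>
      LinearMap.mk₂ k
        (fun p f => LinearMap.lTensor M ((β X W).flip p) ∘ₗ
          coactTwist M (HCategory.act (H := H) X W) ∘ₗ (TensorProduct.mk k M (X ⟶ W)).flip f)
        (fun _ _ _ => by simp [LinearMap.lTensor_add, LinearMap.add_comp])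
        (fun _ _ _ => by simp [LinearMap.lTensor_smul, LinearMap.smul_comp])
        (fun _ _ _ => by simp [LinearMap.comp_add])
        (fun _ _ _ => by simp [LinearMap.comp_smul])

/-- The face maps on `M ⊗ CN_{n+1}`; the last one is
`m ⊗ f⁰ ⊗ ⋯ ⊗ fⁿ⁺¹ ↦ m₍₀₎ ⊗ (S⁻¹(m₍₋₁₎) fⁿ⁺¹) f⁰ ⊗ f¹ ⊗ ⋯ ⊗ fⁿ`. -/
def hopfFace (n i : ℕ) : M ⊗[k] CN k D (n + 1) →ₗ[k] M ⊗[k] CN k D n :=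
  if i ≤ n then LinearMap.lTensor M (DirectSum.lmap fun _ => innerFace k n i)
  else rotate k H M fun _ W => (composeFirst k n).compr₂ (ofLoop k n W)

/-- The operator `m ⊗ f⁰ ⊗ ⋯ ⊗ fⁿ ↦ m₍₀₎ ⊗ S⁻¹(m₍₋₁₎) fⁿ ⊗ f⁰ ⊗ ⋯ ⊗ fⁿ⁻¹`. -/
def hopfCyc : ∀ n : ℕ, M ⊗[k] CN k D n →ₗ[k] M ⊗[k] CN k D n
  | 0 => coactTwist M (loopAct k (D := D) H 0)
  | n + 1 => rotate k H M fun _ W => (prepend k n).compr₂ (ofLoop k (n + 1) W)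

variable (D) in
/-- The space `Zⁿ_H(D, M)` of Hopf-cyclic `n`-cocycles: `φ ∈ Cⁿ_H(D, M)` with `b φ = 0` and
`φ = (-1)ⁿ τ φ`. -/
def hopfCyclicCocycles (n : ℕ) : Submodule k (M ⊗[k] CN k D n →ₗ[k] k) :=
  cochains k D H M n ⊓
    LinearMap.ker (∑ i ∈ Finset.range (n + 2),
      (-1 : k) ^ i • LinearMap.lcomp k k (hopfFace k (D := D) H M n i)) ⊓
    LinearMap.ker (LinearMap.id - (-1 : k) ^ n • LinearMap.lcomp k k (hopfCyc k (D := D) H M n))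

end CyclicNerve

/-! ### Differential graded semicategories, traces and cycles -/

section DG

/-- A (small) differential graded semicategory over `k`: `Hom n X Y` is the degree `n` part of the
complex of morphisms from `X` to `Y`, and `comp h g f` is the composite `g f`. -/
structure DGSemicat (k : Type u) [Field k] where
  Obj : Type u
  Hom : ℕ → Obj → Obj → Type u
  [addCommGroup : ∀ n X Y, AddCommGroup (Hom n X Y)]
  [module : ∀ n X Y, Module k (Hom n X Y)]
  comp : ∀ {j i n : ℕ} (_ : j + i = n) {X Y Z : Obj},
    Hom j Y Z →ₗ[k] Hom i X Y →ₗ[k] Hom n X Z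
  d : ∀ {n m : ℕ} (_ : n + 1 = m) {X Y : Obj}, Hom n X Y →ₗ[k] Hom m X Y
  assoc : ∀ {l j i a b n : ℕ} (hlj : l + j = a) (hji : j + i = b) (h : a + i = n) (h' : l + b = n)
    {W X Y Z : Obj} (p : Hom l Y Z) (q : Hom j X Y) (r : Hom i W X),
    comp h (comp hlj p q) r = comp h' p (comp hji q r)
  d_d : ∀ {n m l : ℕ} (h : n + 1 = m) (h' : m + 1 = l) {X Y : Obj} (f : Hom n X Y),
    d h' (d h f) = 0
  leibniz : ∀ {j i n j' i' n' : ℕ} (h : j + i = n) (hj : j + 1 = j') (hi : i + 1 = i')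
    (hn : n + 1 = n') (h₁ : j' + i = n') (h₂ : j + i' = n') {X Y Z : Obj}
    (g : Hom j Y Z) (f : Hom i X Y),
    d hn (comp h g f) = comp h₁ (d hj g) f + (-1 : k) ^ j • comp h₂ g (d hi f)

attribute [instance] DGSemicat.addCommGroup DGSemicat.module

/-- A left DGH-semicategory: `H` acts on each `Hom n X Y`, compatibly with the differential and
with `h(g f) = (h₁ g)(h₂ f)`. -/
structure DGHSemicat (k : Type u) [Field k] (H : Type v) [Ring H] [HopfAlgebra k H] extends
    DGSemicat k where
  act : ∀ n X Y, H →ₐ[k] Module.End k (Hom n X Y)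
  act_comp : ∀ {j i n : ℕ} (e : j + i = n) (h : H) {X Y Z : Obj} (g : Hom j Y Z) (f : Hom i X Y),
    act n X Z h (comp e g f) =
      TensorProduct.lift (comp e) (tensAct (act j Y Z) (act i X Y) h (g ⊗ₜ[k] f))
  act_d : ∀ {n m : ℕ} (e : n + 1 = m) (h : H) {X Y : Obj} (f : Hom n X Y),
    d e (act n X Y h f) = act m X Y h (d e f)

variable {k : Type u} [Field k]

/-- The degree zero part of `S` is an ordinary category. -/
def DGSemicat.ZeroIsCategory (S : DGSemicat k) : Prop :=
  ∀ X : S.Obj, ∃ e : S.Hom 0 X X,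
    (∀ (Y : S.Obj) (f : S.Hom 0 X Y), S.comp (zero_add 0) f e = f) ∧
    (∀ (Y : S.Obj) (f : S.Hom 0 Y X), S.comp (zero_add 0) e f = f)

/-- The degree zero part of `S` is a left `H`-category. -/
def DGHSemicat.ZeroIsHCategory {H : Type v} [Ring H] [HopfAlgebra k H] (S : DGHSemicat k H) :
    Prop :=
  ∀ X : S.Obj, ∃ e : S.Hom 0 X X,
    (∀ (Y : S.Obj) (f : S.Hom 0 X Y), S.comp (zero_add 0) f e = f) ∧
    (∀ (Y : S.Obj) (f : S.Hom 0 Y X), S.comp (zero_add 0) e f = f) ∧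
    ∀ h : H, S.act 0 X X h e = Coalgebra.counit (R := k) h • e

/-- A closed graded trace of dimension `n` on a DG-semicategory. -/
structure ClosedGradedTrace (S : DGSemicat k) (n : ℕ) where
  T : ∀ X : S.Obj, S.Hom n X X →ₗ[k] k
  closed : ∀ {p : ℕ} (hp : p + 1 = n) (X : S.Obj) (f : S.Hom p X X), T X (S.d hp f) = 0
  trace : ∀ {i j : ℕ} (h : j + i = n) (h' : i + j = n) (X Y : S.Obj) (g : S.Hom i X Y)
    (g' : S.Hom j Y X), T X (S.comp h g' g) = (-1 : k) ^ (i * j) * T Y (S.comp h' g g')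

/-- A closed graded `(H, M)`-trace of dimension `n` on a left DGH-semicategory. -/
structure ClosedGradedHTrace {H : Type v} [Ring H] [HopfAlgebra k H] [BijectiveAntipode k H]
    (S : DGHSemicat k H) (M : Type w) [AddCommGroup M] [Module k M] [Module Hᵐᵒᵖ M]
    [IsScalarTower k Hᵐᵒᵖ M] [SAYD k H M] (n : ℕ) where
  T : ∀ X : S.Obj, M ⊗[k] S.Hom n X X →ₗ[k] k
  invariant : ∀ (h : H) (X : S.Obj) (m : M) (f : S.Hom n X X),
    T X (rightTensAct M (S.act n X X) h (m ⊗ₜ[k] f)) =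
      Coalgebra.counit (R := k) h * T X (m ⊗ₜ[k] f)
  closed : ∀ {p : ℕ} (hp : p + 1 = n) (X : S.Obj) (m : M) (f : S.Hom p X X),
    T X (m ⊗ₜ[k] S.d hp f) = 0
  trace : ∀ {i j : ℕ} (h : j + i = n) (h' : i + j = n) (X Y : S.Obj) (m : M) (g : S.Hom i X Y)
    (g' : S.Hom j Y X), T X (m ⊗ₜ[k] S.comp h g' g) = (-1 : k) ^ (i * j) *
      T Y (LinearMap.lTensor M ((S.comp h').flip g') (coactTwist M (S.act i X Y) (m ⊗ₜ[k] g)))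

variable (D : Type u) [SmallCategory D] [Preadditive D] [Linear k D]

/-- A `k`-linear semifunctor from `D` to the degree zero part of `S`. -/
structure ZeroSemifunctor (S : DGSemicat k) where
  obj : D → S.Obj
  map : ∀ {X Y : D}, (X ⟶ Y) →ₗ[k] S.Hom 0 (obj X) (obj Y)
  map_comp : ∀ {X Y Z : D} (g : Y ⟶ Z) (f : X ⟶ Y),
    map (f ≫ g) = S.comp (zero_add 0) (map g) (map f)

/-- An `H`-linear semifunctor from `D` to the degree zero part of `S`. -/
structure ZeroHSemifunctor {H : Type v} [Ring H] [HopfAlgebra k H] [HCategory k H D]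
    (S : DGHSemicat k H) extends ZeroSemifunctor D S.toDGSemicat where
  map_act : ∀ (h : H) {X Y : D} (f : X ⟶ Y),
    map (HCategory.act (k := k) X Y h f) = S.act 0 (obj X) (obj Y) h (map f)

variable {D}

/-- `f⁰ ⊗ ⋯ ⊗ fⁿ ↦ ρ(f⁰) ∂(ρ(f¹)) ⋯ ∂(ρ(fⁿ))`. -/
def ZeroSemifunctor.form {S : DGSemicat k} (ρ : ZeroSemifunctor D S) :
    ∀ (n : ℕ) {X Y : D}, paths k n X Y →ₗ[k] S.Hom n (ρ.obj X) (ρ.obj Y)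
  | 0, _, _ => ρ.map
  | n + 1, _, _ => liftAppend fun _ =>
      (S.comp (rfl : n + 1 = n + 1)).compl₁₂ (ρ.form n) (S.d (zero_add 1) ∘ₗ ρ.map)

open scoped Classical in
/-- The character `f⁰ ⊗ ⋯ ⊗ fⁿ ↦ T(ρ(f⁰) ∂(ρ(f¹)) ⋯ ∂(ρ(fⁿ)))`. -/
def ClosedGradedTrace.character {S : DGSemicat k} {n : ℕ} (T : ClosedGradedTrace S n)
    (ρ : ZeroSemifunctor D S) : CN k D n →ₗ[k] k :=
  DirectSum.toModule k D k fun X => T.T (ρ.obj X) ∘ₗ ρ.form n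

open scoped Classical in
/-- The character `m ⊗ f⁰ ⊗ ⋯ ⊗ fⁿ ↦ T(m ⊗ ρ(f⁰) ∂(ρ(f¹)) ⋯ ∂(ρ(fⁿ)))`. -/
def ClosedGradedHTrace.character {H : Type v} [Ring H] [HopfAlgebra k H] [BijectiveAntipode k H]
    [HCategory k H D] {S : DGHSemicat k H} {M : Type w} [AddCommGroup M] [Module k M]
    [Module Hᵐᵒᵖ M] [IsScalarTower k Hᵐᵒᵖ M] [SAYD k H M] {n : ℕ}
    (T : ClosedGradedHTrace S M n) (ρ : ZeroHSemifunctor D S) : M ⊗[k] CN k D n →ₗ[k] k :=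
  TensorProduct.lift <| LinearMap.flip <| DirectSum.toModule k D (M →ₗ[k] k) fun X =>
    (TensorProduct.curry (T.T (ρ.obj X))).flip ∘ₗ ρ.form n

end DG

/-! ### The universal DG-semicategory -/

section Universal

variable (k : Type u) [Field k] {D : Type u} [SmallCategory D] [Preadditive D] [Linear k D]

/-- The space `Hom(X, Y) ⊕ k` if `X = Y`, and `Hom(X, Y)` otherwise (the functions on the proofs of
`X = Y` are a copy of `k` if `X = Y`, and are zero otherwise). These are the morphism spaces of the
category obtained from `D` by adjoining new identities. -/
def tilde (X Y : D) : ModuleCat.{u} k := ModuleCat.of k ((X ⟶ Y) × (PLift (X = Y) →₀ k))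

/-- The space of forms `⨁ (f⁰ + μ) df¹ ⋯ dfⁿ`, the sum being
`⨁ tilde X₁ Y ⊗ Hom(X₂, X₁) ⊗ ⋯ ⊗ Hom(X, Xₙ)`. Here `append ω g` is `ω dg`. -/
abbrev forms (n : ℕ) (X Y : D) : Type u := strings k (tilde k) n X Y

/-- The inclusion of `Hom(X, Y)` in the forms of degree zero. -/
def formsInl (X Y : D) : (X ⟶ Y) →ₗ[k] forms k 0 X Y :=
  LinearMap.inl k (X ⟶ Y) (PLift (X = Y) →₀ k)

/-- The adjoined identity of `X`, as a form of degree zero from `X` to `Y` when `X = Y`. -/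
def formsUnit {X Y : D} (h : X = Y) : forms k 0 X Y :=
  LinearMap.inr k (X ⟶ Y) (PLift (X = Y) →₀ k) (Finsupp.single ⟨h⟩ 1)

/-- The adjoined identity of `X`. -/
def formsOne (X : D) : forms k 0 X X := formsUnit k rfl

variable {k} in
/-- The linear map `f + μ ↦ φ(f) + μ ψ`, where `ψ` is needed only if `X = Y`. -/
def formsZeroLift {X Y : D} {N : Type*} [AddCommGroup N] [Module k N] (φ : (X ⟶ Y) →ₗ[k] N)
    (ψ : X = Y → N) : forms k 0 X Y →ₗ[k] N :=
  LinearMap.coprod φ (Finsupp.lsum k fun h : PLift (X = Y) =>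
    LinearMap.toSpanSingleton k N (ψ h.down))

/-- The differential `∂((f⁰ + μ) df¹ ⋯ dfⁿ) = 1 df⁰ df¹ ⋯ dfⁿ`. -/
def formsD : ∀ (n : ℕ) {X Y : D}, forms k n X Y →ₗ[k] forms k (n + 1) X Y
  | 0, _, Y => formsZeroLift (append (formsOne k Y))
      (fun _ => 0)
  | n + 1, _, _ => liftAppend fun _ => append ∘ₗ formsD n

/-- The product `ω g` of a form and a morphism of `D`, determined by `(f⁰ + μ) g = f⁰ g + μ g` and
`(ω df) g = ω d(f g) - (ω f) dg`. -/
def formsMulHom : ∀ (n : ℕ) {X W Y : D}, forms k n W Y →ₗ[k] (X ⟶ W) →ₗ[k] forms k n X Y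
  | 0, X, W, Y => (formsZeroLift (compMap k X W Y) fun h => Linear.rightComp k X (eqToHom h)).compr₂
      (formsInl k X Y)
  | n + 1, X, W, _ => liftAppend fun V =>
      LinearMap.mk₂ k
        (fun ω f => append ω ∘ₗ compMap k X W V f - append (formsMulHom n ω f))
        (fun _ _ _ => by ext; simp; abel)
        (fun _ _ _ => by ext; simp [smul_sub])
        (fun _ _ _ => by ext; simp; abel)
        (fun _ _ _ => by ext; simp [smul_sub])

/-- The identification of forms along an equality of objects. -/
def formsCast (n : ℕ) {X W Y : D} (h : X = W) : forms k n W Y →ₗ[k] forms k n X Y :=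
  h ▸ LinearMap.id

/-- The product `ω (g + μ) = ω g + μ ω`. -/
def formsMulTilde (n : ℕ) {X W Y : D} :
    forms k n W Y →ₗ[k] forms k 0 X W →ₗ[k] forms k n X Y :=
  LinearMap.flip (formsZeroLift (formsMulHom k n).flip fun h => formsCast k n h)

/-- The composition of forms, with `ω (η dg) = (ω η) dg`. Together with the products above, this
amounts to
`((f⁰ + μ) df¹ ⋯ dfʲ) ((fʲ⁺¹ + μ') dfʲ⁺² ⋯ dfᵐ) =`
`  ∑ₛ (-1)ʲ⁻ˢ (f⁰ + μ) df¹ ⋯ d(fˢ fˢ⁺¹) ⋯ dfᵐ + (-1)ʲ (f⁰ + μ) f¹ df² ⋯ dfᵐ`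
`    + μ' (f⁰ + μ) df¹ ⋯ dfʲ dfʲ⁺² ⋯ dfᵐ`, where `s` runs from `1` to `j`. -/
def formsComp : ∀ {j i n : ℕ} (_ : j + i = n) {X Y Z : D},
    forms k j Y Z →ₗ[k] forms k i X Y →ₗ[k] forms k n X Z
  | j, 0, _, rfl, _, _, _ => formsMulTilde k j
  | _, _ + 1, 0, h, _, _, _ => absurd h (by omega)
  | j, i + 1, n + 1, h, _, Y, Z => LinearMap.flip <| liftAppend fun _ =>
      LinearMap.mk₂ k
        (fun η f => append.flip f ∘ₗ (formsComp (j := j) (i := i) (n := n) (by omega)).flip η)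
        (fun _ _ _ => by ext; simp) (fun _ _ _ => by ext; simp)
        (fun _ _ _ => by ext; simp) (fun _ _ _ => by ext; simp)


variable {k}

@[simp]
theorem formsZeroLift_inl {X Y : D} {N : Type*} [AddCommGroup N] [Module k N] (φ : (X ⟶ Y) →ₗ[k] N)
    (ψ : X = Y → N) (f : X ⟶ Y) : formsZeroLift φ ψ (formsInl k X Y f) = φ f := by
  change LinearMap.coprod φ _ (f, 0) = φ f
  simp

@[simp]
theorem formsZeroLift_unit {X Y : D} {N : Type*} [AddCommGroup N] [Module k N] (φ : (X ⟶ Y) →ₗ[k] N)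
    (ψ : X = Y → N) (h : X = Y) : formsZeroLift φ ψ (formsUnit k h) = ψ h := by
  change LinearMap.coprod φ _ (0, Finsupp.single _ 1) = ψ h
  simp

theorem formsZero_induction {X Y : D} {P : forms k 0 X Y → Prop} (x : forms k 0 X Y)
    (add : ∀ x y, P x → P y → P (x + y)) (inl : ∀ f, P (formsInl k X Y f))
    (smul : ∀ (c : k) x, P x → P (c • x)) (unit : ∀ h, P (formsUnit k h)) : P x := by
  obtain ⟨f, μ⟩ := x
  have hμ : P (LinearMap.inr k (X ⟶ Y) (PLift (X = Y) →₀ k) μ) := by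
    induction μ using Finsupp.induction_linear with
    | zero =>
      rw [map_zero]
      have := inl 0
      rw [map_zero] at this
      exact this
    | add a b ha hb => rw [map_add]; exact add _ _ ha hb
    | single h c =>
      have := smul c _ (unit h.down)
      rw [← mul_one c, ← smul_eq_mul, ← Finsupp.smul_single, map_smul]
      exact this
  have e : LinearMap.inl k (X ⟶ Y) (PLift (X = Y) →₀ k) f +
      LinearMap.inr k (X ⟶ Y) (PLift (X = Y) →₀ k) μ = (f, μ) :=
    Prod.ext (add_zero f) (zero_add μ)
  rw [← e]
  exact add _ _ (inl f) hμ

@[simp]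
theorem formsD_append {n : ℕ} {X W Y : D} (ω : forms k n W Y) (g : X ⟶ W) :
    formsD k (n + 1) (append ω g) = append (formsD k n ω) g := by
  simp [formsD]

@[simp]
theorem formsD_inl {X Y : D} (f : X ⟶ Y) : formsD k 0 (formsInl k X Y f) =
    append (formsOne k Y) f := by
  simp [formsD]

@[simp]
theorem formsD_unit {X Y : D} (h : X = Y) : formsD k 0 (formsUnit k h) = 0 := by
  simp [formsD]

@[simp]
theorem formsMulHom_inl {X W Y : D} (f : W ⟶ Y) (g : X ⟶ W) :
    formsMulHom k 0 (formsInl k W Y f) g = formsInl k X Y (g ≫ f) := by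
  simp [formsMulHom, compMap]

@[simp]
theorem formsMulHom_one {X W : D} (g : X ⟶ W) :
    formsMulHom k 0 (formsOne k W) g = formsInl k X W g := by
  simp [formsMulHom, formsOne]

@[simp]
theorem formsMulHom_append {n : ℕ} {X W V Y : D} (ω : forms k n V Y) (f : W ⟶ V) (g : X ⟶ W) :
    formsMulHom k (n + 1) (append ω f) g =
      append ω (g ≫ f) - append (formsMulHom k n ω f) g := by
  simp [formsMulHom, compMap]

@[simp]
theorem formsComp_inl {j : ℕ} {X Y Z : D} (h : j + 0 = j) (ω : forms k j Y Z) (g : X ⟶ Y) :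
    formsComp k h ω (formsInl k X Y g) = formsMulHom k j ω g := by
  simp [formsComp, formsMulTilde]

@[simp]
theorem formsComp_one {j : ℕ} {Y Z : D} (h : j + 0 = j) (ω : forms k j Y Z) :
    formsComp k h ω (formsOne k Y) = ω := by
  simp [formsComp, formsMulTilde, formsOne, formsCast]

@[simp]
theorem formsComp_append {j i n : ℕ} {X W Y Z : D} (h : j + (i + 1) = n + 1) (ω : forms k j Y Z)
    (η : forms k i W Y) (g : X ⟶ W) :
    formsComp k h ω (append η g) = append (formsComp k (by omega : j + i = n) ω η) g := by
  simp [formsComp]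

theorem formsMulHom_mulHom : ∀ (n : ℕ) {X W V Y : D} (ω : forms k n V Y) (f : W ⟶ V) (g : X ⟶ W),
    formsMulHom k n (formsMulHom k n ω f) g = formsMulHom k n ω (g ≫ f)
  | 0, X, W, V, Y, ω, f, g => by
    induction ω using formsZero_induction with
    | add x y hx hy => simp only [map_add, LinearMap.add_apply, hx, hy]
    | smul c x hx => simp only [map_smul, LinearMap.smul_apply, hx]
    | inl f' => simp
    | unit h => cases h; change formsMulHom k 0 (formsMulHom k 0 (formsOne k V) f) g =
                  formsMulHom k 0 (formsOne k V) (g ≫ f); simp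
  | n + 1, X, W, V, Y, ω, f, g => by
    induction ω using strings_induction with
    | zero => simp
    | add x y hx hy => simp only [map_add, LinearMap.add_apply, hx, hy]
    | app U ω f' => simp [formsMulHom_mulHom n]

theorem formsComp_mulHom : ∀ {l j a : ℕ} (h : l + j = a) {W X Y Z : D} (ω : forms k l Y Z)
    (η : forms k j X Y) (g : W ⟶ X),
    formsMulHom k a (formsComp k h ω η) g = formsComp k h ω (formsMulHom k j η g)
  | l, 0, _, rfl, W, X, Y, Z, ω, η, g => by
    induction η using formsZero_induction with
    | add x y hx hy => simp only [map_add, LinearMap.add_apply, hx, hy]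
    | smul c x hx => simp only [map_smul, LinearMap.smul_apply, hx]
    | inl f => simp [formsMulHom_mulHom]
    | unit h =>
      cases h
      change formsMulHom k l (formsComp k _ ω (formsOne k X)) g =
        formsComp k _ ω (formsMulHom k 0 (formsOne k X) g)
      simp
  | _, _ + 1, 0, h, _, _, _, _, _, _, _ => absurd h (by omega)
  | l, j + 1, a + 1, h, W, X, Y, Z, ω, η, g => by
    induction η using strings_induction with
    | zero => simp
    | add x y hx hy => simp only [map_add, LinearMap.add_apply, hx, hy]
    | app U η f => simp [formsComp_mulHom (by omega : l + j = a)]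

theorem formsComp_assoc {l j : ℕ} : ∀ {i a b n : ℕ} (hlj : l + j = a) (hji : j + i = b)
    (h : a + i = n) (h' : l + b = n) {W X Y Z : D} (p : forms k l Y Z) (q : forms k j X Y)
    (r : forms k i W X),
    formsComp k h (formsComp k hlj p q) r = formsComp k h' p (formsComp k hji q r)
  | 0, _, _, _, rfl, rfl, rfl, h', W, X, Y, Z, p, q, r => by
    induction r using formsZero_induction with
    | add x y hx hy => simp only [map_add, hx, hy]
    | smul c x hx => simp only [map_smul, hx]
    | inl f => simp [formsComp_mulHom]
    | unit h =>
      cases h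
      change formsComp k _ (formsComp k _ p q) (formsOne k W) =
        formsComp k h' p (formsComp k _ q (formsOne k W))
      simp
  | i + 1, a, b + 1, n + 1, hlj, hji, h, h', W, X, Y, Z, p, q, r => by
    induction r using strings_induction with
    | zero => simp
    | add x y hx hy => simp only [map_add, hx, hy]
    | app U r f =>
      simp [formsComp_assoc hlj (by omega : j + i = b) (by omega : a + i = n) (by omega)]
  | _ + 1, _, 0, _, _, h, _, _, _, _, _, _, _, _, _ => absurd h (by omega)
  | _ + 1, _, _ + 1, 0, _, _, h, _, _, _, _, _, _, _, _ => absurd h (by omega)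

theorem formsD_formsD : ∀ (n : ℕ) {X Y : D} (ω : forms k n X Y),
    formsD k (n + 1) (formsD k n ω) = 0
  | 0, X, Y, ω => by
    induction ω using formsZero_induction with
    | add x y hx hy => simp only [map_add, hx, hy, add_zero]
    | smul c x hx => simp only [map_smul, hx, smul_zero]
    | inl f => simp [formsOne]
    | unit h => simp
  | n + 1, X, Y, ω => by
    induction ω using strings_induction with
    | zero => simp
    | add x y hx hy => simp only [map_add, hx, hy, add_zero]
    | app U ω f => simp [formsD_formsD n]

theorem formsD_mulHom : ∀ (j : ℕ) {X Y Z : D} (ω : forms k j Y Z) (g : X ⟶ Y),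
    formsD k j (formsMulHom k j ω g) =
      formsMulHom k (j + 1) (formsD k j ω) g + (-1 : k) ^ j • append ω g
  | 0, X, Y, Z, ω, g => by
    induction ω using formsZero_induction with
    | add x y hx hy =>
      simp only [map_add, LinearMap.add_apply, hx, hy, smul_add]; abel
    | smul c x hx =>
      simp only [map_smul, LinearMap.smul_apply, hx, smul_add, smul_comm c]
    | inl f => simp
    | unit h =>
      cases h
      change formsD k 0 (formsMulHom k 0 (formsOne k Y) g) =
        formsMulHom k 1 (formsD k 0 (formsOne k Y)) g + (-1 : k) ^ 0 • append (formsOne k Y) g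
      rw [formsMulHom_one, formsD_inl]
      simp [formsOne]
  | j + 1, X, Y, Z, ω, g => by
    induction ω using strings_induction with
    | zero => simp
    | add x y hx hy =>
      simp only [map_add, LinearMap.add_apply, hx, hy, smul_add]; abel
    | app U ω f => simp [formsD_mulHom j, pow_succ]; abel

theorem formsD_comp {j : ℕ} : ∀ {i n : ℕ} (h : j + i = n) (h₁ : j + 1 + i = n + 1)
    (h₂ : j + (i + 1) = n + 1) {X Y Z : D} (g : forms k j Y Z) (f : forms k i X Y),
    formsD k n (formsComp k h g f) =
      formsComp k h₁ (formsD k j g) f + (-1 : k) ^ j • formsComp k h₂ g (formsD k i f)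
  | 0, _, rfl, h₁, h₂, X, Y, Z, g, f => by
    induction f using formsZero_induction with
    | add x y hx hy => simp only [map_add, hx, hy, smul_add]; abel
    | smul c x hx => simp only [map_smul, hx, smul_add, smul_comm c]
    | inl f => simp [formsD_mulHom]
    | unit h =>
      cases h
      change formsD k j (formsComp k _ g (formsOne k X)) =
        formsComp k h₁ (formsD k j g) (formsOne k X) +
          (-1 : k) ^ j • formsComp k h₂ g (formsD k 0 (formsOne k X))
      rw [formsComp_one, formsComp_one]
      simp [formsOne]
  | i + 1, n + 1, h, h₁, h₂, X, Y, Z, g, f => by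
    induction f using strings_induction with
    | zero => simp
    | add x y hx hy => simp only [map_add, hx, hy, smul_add]; abel
    | app U f a =>
      simp [formsD_comp (by omega : j + i = n) (by omega) (by omega)]
  | _ + 1, 0, h, _, _, _, _, _, _, _ => absurd h (by omega)

variable (k) in
/-- The differential with its degrees as variables. -/
def formsD' {n m : ℕ} (h : n + 1 = m) {X Y : D} : forms k n X Y →ₗ[k] forms k m X Y :=
  h ▸ formsD k n

variable (k D) in
/-- The universal DG-semicategory `Ω D`. -/
def Omega : DGSemicat k where
  Obj := D
  Hom n X Y := forms k n X Y
  comp h := formsComp k h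
  d h := formsD' k h
  assoc hlj hji h h' _ _ _ _ p q r := formsComp_assoc hlj hji h h' p q r
  d_d := by
    rintro n _ _ rfl rfl X Y f
    exact formsD_formsD n f
  leibniz := by
    rintro j i n _ _ _ h rfl rfl rfl h₁ h₂ X Y Z g f
    exact formsD_comp h h₁ h₂ g f


section HAction

variable {k : Type u} [Field k] {H : Type v} [Ring H] [HopfAlgebra k H]
variable {D : Type u} [SmallCategory D] [Preadditive D] [Linear k D] [HCategory k H D]

variable (k H) in
/-- The action `h (f + μ) = h f + ε(h) μ`. -/
def tildeAct (X Y : D) : H →ₐ[k] Module.End k (tilde k X Y) :=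
  (LinearMap.prodMapAlgHom k (X ⟶ Y) (PLift (X = Y) →₀ k)).comp
    (AlgHom.prod (HCategory.act X Y) (trivAct (PLift (X = Y) →₀ k)))

variable (k H) in
/-- The action `h ((f⁰ + μ) df¹ ⋯ dfⁿ) = (h₁ f⁰ + ε(h₁) μ) d(h₂ f¹) ⋯ d(hₙ₊₁ fⁿ)`. -/
def formsAct (n : ℕ) (X Y : D) : H →ₐ[k] Module.End k (forms k n X Y) :=
  stringsAct (tildeAct k H) n X Y

@[simp]
theorem formsAct_inl {X Y : D} (h : H) (f : X ⟶ Y) :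
    formsAct k H 0 X Y h (formsInl k X Y f) = formsInl k X Y (HCategory.act (k := k) X Y h f) := by
  change (HCategory.act X Y h f, Coalgebra.counit (R := k) h • (0 : PLift (X = Y) →₀ k)) =
    (HCategory.act X Y h f, 0)
  rw [smul_zero]

@[simp]
theorem formsAct_unit {X Y : D} (h : H) (e : X = Y) :
    formsAct k H 0 X Y h (formsUnit k e) = Coalgebra.counit (R := k) h • formsUnit k e := by
  change (HCategory.act X Y h 0, Coalgebra.counit (R := k) h • Finsupp.single _ (1 : k)) =
    (Coalgebra.counit (R := k) h • 0, Coalgebra.counit (R := k) h • Finsupp.single _ (1 : k))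
  rw [map_zero, smul_zero]

@[simp]
theorem formsAct_append {n : ℕ} {X W Y : D} (h : H) (ω : forms k n W Y) (f : X ⟶ W) :
    formsAct k H (n + 1) X Y h (append ω f) = ∑ i ∈ (Coalgebra.Repr.arbitrary k h).index,
      append (formsAct k H n W Y ((Coalgebra.Repr.arbitrary k h).left i) ω)
        (HCategory.act (k := k) X W ((Coalgebra.Repr.arbitrary k h).right i) f) := by
  classical
  change DirectSum.lmap (fun W => tensAct (formsAct k H n W Y) (HCategory.act X W) h)
    (DirectSum.lof k D (fun W : D => forms k n W Y ⊗[k] (X ⟶ W)) W (ω ⊗ₜ[k] f)) = _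
  rw [DirectSum.lmap_lof, tensAct_tmul, map_sum]
  rfl

theorem act_compMap {X Y Z : D} (h : H) (g : Y ⟶ Z) (f : X ⟶ Y) :
    HCategory.act (k := k) X Z h (f ≫ g) = ∑ i ∈ (Coalgebra.Repr.arbitrary k h).index,
      HCategory.act (k := k) X Y ((Coalgebra.Repr.arbitrary k h).right i) f ≫
        HCategory.act (k := k) Y Z ((Coalgebra.Repr.arbitrary k h).left i) g := by
  rw [HCategory.act_comp, tensAct_tmul, map_sum]
  simp [compMap]

theorem sum_counit_left_smul {V : Type*} [AddCommGroup V] [Module k V]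
    (α : H →ₐ[k] Module.End k V) (h : H) (v : V) :
    ∑ i ∈ (Coalgebra.Repr.arbitrary k h).index,
      Coalgebra.counit (R := k) ((Coalgebra.Repr.arbitrary k h).left i) •
        α ((Coalgebra.Repr.arbitrary k h).right i) v = α h v := by
  have := congrArg (TensorProduct.lift (LinearMap.lsmul k V) ∘ₗ
    LinearMap.lTensor k (α.toLinearMap.flip v))
    (Coalgebra.sum_counit_tmul_eq (Coalgebra.Repr.arbitrary k h))
  simpa [map_sum, -Coalgebra.sum_counit_tmul_eq] using this

theorem sum_counit_right_smul {V : Type*} [AddCommGroup V] [Module k V]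
    (α : H →ₐ[k] Module.End k V) (h : H) (v : V) :
    ∑ i ∈ (Coalgebra.Repr.arbitrary k h).index,
      Coalgebra.counit (R := k) ((Coalgebra.Repr.arbitrary k h).right i) •
        α ((Coalgebra.Repr.arbitrary k h).left i) v = α h v := by
  have := congrArg (TensorProduct.lift (LinearMap.lsmul k V).flip ∘ₗ
    LinearMap.rTensor k (α.toLinearMap.flip v))
    (Coalgebra.sum_tmul_counit_eq (Coalgebra.Repr.arbitrary k h))
  simpa [map_sum, -Coalgebra.sum_tmul_counit_eq] using this

theorem formsAct_mulHom : ∀ (n : ℕ) {X W Y : D} (h : H) (ω : forms k n W Y) (g : X ⟶ W),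
    formsAct k H n X Y h (formsMulHom k n ω g) = ∑ i ∈ (Coalgebra.Repr.arbitrary k h).index,
      formsMulHom k n (formsAct k H n W Y ((Coalgebra.Repr.arbitrary k h).left i) ω)
        (HCategory.act (k := k) X W ((Coalgebra.Repr.arbitrary k h).right i) g)
  | 0, X, W, Y, h, ω, g => by
    induction ω using formsZero_induction with
    | add x y hx hy =>
      simp only [map_add, LinearMap.add_apply, hx, hy, Finset.sum_add_distrib]
    | smul c x hx => simp only [map_smul, LinearMap.smul_apply, hx, Finset.smul_sum]
    | inl f => simp [act_compMap, map_sum]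
    | unit e =>
      cases e
      change formsAct k H 0 X W h (formsMulHom k 0 (formsOne k W) g) = _
      rw [formsMulHom_one, formsAct_inl]
      simp only [formsAct_unit, map_smul, LinearMap.smul_apply]
      change _ = ∑ i ∈ _, _ • formsMulHom k 0 (formsOne k W) _
      rw [← sum_counit_left_smul (HCategory.act (k := k) X W) h g, map_sum]
      simp only [formsMulHom_one, map_smul]
  | n + 1, X, W, Y, h, ω, g => by
    induction ω using strings_induction with
    | zero => simp
    | add x y hx hy =>
      simp only [map_add, LinearMap.add_apply, hx, hy, Finset.sum_add_distrib]
    | app U ω f =>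
      have e := sum_act_coassoc (formsAct k H n U Y) (HCategory.act (k := k) W U)
        (HCategory.act (k := k) X W)
        (LinearMap.mk₂ k (fun (ω : forms k n U Y) (f : W ⟶ U) => append ω ∘ₗ compMap k X W U f)
          (fun _ _ _ => by ext; simp) (fun _ _ _ => by ext; simp)
          (fun _ _ _ => by ext; simp) (fun _ _ _ => by ext; simp)) h ω f g
      simp only [LinearMap.mk₂_apply, LinearMap.comp_apply] at e
      simp only [formsMulHom_append, map_sub, formsAct_append, map_sum, LinearMap.sum_apply,
        formsAct_mulHom n, Finset.sum_sub_distrib, act_compMap]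
      congr 1
      exact e.symm

theorem formsAct_comp : ∀ {j i n : ℕ} (e : j + i = n) (h : H) {X Y Z : D} (ω : forms k j Y Z)
    (η : forms k i X Y),
    formsAct k H n X Z h (formsComp k e ω η) = ∑ s ∈ (Coalgebra.Repr.arbitrary k h).index,
      formsComp k e (formsAct k H j Y Z ((Coalgebra.Repr.arbitrary k h).left s) ω)
        (formsAct k H i X Y ((Coalgebra.Repr.arbitrary k h).right s) η)
  | j, 0, _, rfl, h, X, Y, Z, ω, η => by
    induction η using formsZero_induction with
    | add x y hx hy => simp only [map_add, hx, hy, Finset.sum_add_distrib]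
    | smul c x hx => simp only [map_smul, hx, Finset.smul_sum]
    | inl f => simp [formsAct_mulHom]
    | unit u =>
      cases u
      simp only [formsAct_unit, map_smul]
      change formsAct k H j X Z h (formsComp k _ ω (formsOne k X)) =
        ∑ i ∈ _, _ • formsComp k _ _ (formsOne k X)
      simp only [formsComp_one]
      rw [sum_counit_right_smul]
  | _, _ + 1, 0, e, _, _, _, _, _, _ => absurd e (by omega)
  | j, i + 1, n + 1, e, h, X, Y, Z, ω, η => by
    induction η using strings_induction with
    | zero => simp
    | add x y hx hy => simp only [map_add, hx, hy, Finset.sum_add_distrib]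
    | app U η f =>
      have key := sum_act_coassoc (formsAct k H j Y Z) (formsAct k H i U Y)
        (HCategory.act (k := k) X U)
        ((formsComp k (by omega : j + i = n)).compr₂ append) h ω η f
      simp only [LinearMap.compr₂_apply] at key
      simp only [formsComp_append, formsAct_append, formsAct_comp (by omega : j + i = n), map_sum,
        LinearMap.sum_apply]
      exact key

theorem formsAct_comp_lift {j i n : ℕ} (e : j + i = n) (h : H) {X Y Z : D} (ω : forms k j Y Z)
    (η : forms k i X Y) :
    formsAct k H n X Z h (formsComp k e ω η) = TensorProduct.lift (formsComp k e)
      (tensAct (formsAct k H j Y Z) (formsAct k H i X Y) h (ω ⊗ₜ[k] η)) := by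
  rw [tensAct_tmul, map_sum]
  exact formsAct_comp e h ω η

theorem formsAct_d : ∀ (n : ℕ) (h : H) {X Y : D} (ω : forms k n X Y),
    formsD k n (formsAct k H n X Y h ω) = formsAct k H (n + 1) X Y h (formsD k n ω)
  | 0, h, X, Y, ω => by
    induction ω using formsZero_induction with
    | add x y hx hy => simp only [map_add, hx, hy]
    | smul c x hx => simp only [map_smul, hx]
    | inl f =>
      simp only [formsAct_inl, formsD_inl, formsAct_append, formsOne, formsAct_unit, map_smul,
        LinearMap.smul_apply]
      rw [← sum_counit_left_smul (HCategory.act (k := k) X Y) h f, map_sum]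
      simp only [map_smul]
    | unit u => simp
  | n + 1, h, X, Y, ω => by
    induction ω using strings_induction with
    | zero => simp
    | add x y hx hy => simp only [map_add, hx, hy]
    | app U ω f => simp [formsAct_d n, map_sum]

variable (k H D) in
/-- The universal DG-semicategory `Ω D` of a left `H`-category as a left DGH-semicategory. -/
def OmegaH : DGHSemicat k H where
  toDGSemicat := Omega k D
  act n X Y := formsAct k H n (D := D) X Y
  act_comp e h _ _ _ g f := formsAct_comp_lift e h g f
  act_d := by
    rintro n _ rfl h X Y f
    exact formsAct_d n h f

end HAction

end Universal

/-! ### Traces on the universal DG-semicategory and the cochains they define -/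

section Comparison

variable {k : Type u} [Field k] {D : Type u} [SmallCategory D] [Preadditive D] [Linear k D]

variable (k D) in
/-- The inclusion of `D` in the degree zero part of `Ω D`. -/
def omegaIncl : ZeroSemifunctor D (Omega k D) where
  obj X := X
  map {X Y} := formsInl k X Y
  map_comp g f := by
    change _ = formsComp k _ (formsInl k _ _ g) (formsInl k _ _ f)
    rw [formsComp_inl, formsMulHom_inl]
    rfl

/-- `f⁰ ⊗ ⋯ ⊗ fⁿ ↦ f⁰ df¹ ⋯ dfⁿ`. -/
def pathForm : ∀ (n : ℕ) {X Y : D}, paths k n X Y →ₗ[k] forms k n X Y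
  | 0, X, Y => formsInl k X Y
  | n + 1, _, _ => liftAppend fun _ => append ∘ₗ pathForm n

/-- A closed graded trace on `Ω D` as a family of functionals on forms. -/
def ClosedGradedTrace.onForms {n : ℕ} (T : ClosedGradedTrace (Omega k D) n) (X : D) :
    forms k n X X →ₗ[k] k := T.T X

open scoped Classical in
/-- The map `f⁰ ⊗ ⋯ ⊗ fⁿ ↦ T(f⁰ df¹ ⋯ dfⁿ)` for a closed graded trace on `Ω D`. -/
def ClosedGradedTrace.cochain {n : ℕ} (T : ClosedGradedTrace (Omega k D) n) :
    CN k D n →ₗ[k] k :=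
  DirectSum.toModule k D k fun X => T.onForms X ∘ₗ pathForm n

/-- A closed graded `(H, M)`-trace on `Ω D` as a family of functionals on `M ⊗ forms`. -/
def ClosedGradedHTrace.onForms {H : Type v} [Ring H] [HopfAlgebra k H] [BijectiveAntipode k H]
    [HCategory k H D] {M : Type w} [AddCommGroup M] [Module k M]
    [Module Hᵐᵒᵖ M] [IsScalarTower k Hᵐᵒᵖ M] [SAYD k H M] {n : ℕ}
    (T : ClosedGradedHTrace (OmegaH k H D) M n) (X : D) :
    M ⊗[k] forms k n X X →ₗ[k] k := T.T X

open scoped Classical in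
/-- The map `m ⊗ f⁰ ⊗ ⋯ ⊗ fⁿ ↦ T(m ⊗ f⁰ df¹ ⋯ dfⁿ)` for a closed graded `(H, M)`-trace on `Ω D`. -/
def ClosedGradedHTrace.cochain {H : Type v} [Ring H] [HopfAlgebra k H] [BijectiveAntipode k H]
    [HCategory k H D] {M : Type w} [AddCommGroup M] [Module k M]
    [Module Hᵐᵒᵖ M] [IsScalarTower k Hᵐᵒᵖ M] [SAYD k H M] {n : ℕ}
    (T : ClosedGradedHTrace (OmegaH k H D) M n) : M ⊗[k] CN k D n →ₗ[k] k :=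
  TensorProduct.lift <| LinearMap.flip <| DirectSum.toModule k D (M →ₗ[k] k) fun X =>
    (TensorProduct.curry (T.onForms X)).flip ∘ₗ pathForm n

end Comparison

end HopfCyclic

end

open HopfCyclic

/-!
# Hopf-cyclic cocycles as characters of cycles

Let `ρ` be a semifunctor into the degree zero part of a DG-semicategory. Everything rests on the
form `ω = ρ(f⁰) ∂ρ(f¹) ⋯ ∂ρ(fⁿ)` of a string and on its behaviour under the operations on strings:
prepending `g` gives `ρ(g) ∂ω` (`ZeroSemifunctor.form_prepend`), and the alternating sum of the inner
faces of `f⁰ ⊗ ⋯ ⊗ fⁿ ⊗ g` gives `(-1)ⁿ ω ρ(g)` (`ZeroSemifunctor.form_innerBoundary`).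

*Characters are cocycles* (`ClosedGradedHTrace.character_mem`). The trace property for
`ω · ρ(fⁿ⁺¹)` turns the sum of the inner faces into the cyclic face, which gives `b φ = 0`. The trace
property for `ω · ∂ρ(fⁿ)`, followed by integration by parts, gives the cyclic invariance; in degree
zero one uses instead the identities of the degree zero part. The invariance of the trace gives the
`H`-linearity of `φ`. For `S = Ω D` and the inclusion of `D`, this shows in particular that a closed
graded trace on `Ω D` defines a cocycle.

*Cocycles define traces* (`traceOfCocycle`). Given a cocycle `φ`, set
`T(m ⊗ (f⁰ + μ) df¹ ⋯ dfⁿ) = φ(m ⊗ f⁰ ⊗ ⋯ ⊗ fⁿ)`. This is closed because the differential of a form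
starts with an adjoined identity. The trace identity for `T` is multiplicative in the form that is
moved to the front (`HasTraceIdentity.comp`); in the twisted setting this needs the coassociativity
of the coaction and `Δ(S⁻¹ h) = S⁻¹ h₂ ⊗ S⁻¹ h₁` (`comul_antipodeInv`, `coactTwist_product`). So it
has to be checked only on the adjoined identities, on `df`, where it is the cyclic invariance of
`φ`, and on `f`, where it is `b φ = 0` together with the case of `df`.

*Uniqueness.* In positive degree every form is the sum of a form `f⁰ df¹ ⋯ dfⁿ` and of an exact
form (`exists_eq_pathForm_add_formsD`), so a closed trace is determined by its cochain. In degree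
zero the values on the adjoined identities are free, hence the normalization.

*The ordinary case* is the case `H = k = M`: the twist by the coaction is then the identity
(`coactTwist_self`), and cochains on `k ⊗ CN_n` are cochains on `CN_n` (`scalarCochain_mem`).
-/

noncomputable section

namespace HopfCyclic

/-! ### The coproduct of the antipode and of its inverse -/

section HopfAlgebraIdentities

open Coalgebra HopfAlgebra

variable {k : Type u} [Field k] {H : Type v} [Ring H] [HopfAlgebra k H]

/-- In Sweedler notation, `S(r₁) r₂ ⊗ S(a) r₃ = 1 ⊗ S(a) r`. -/
theorem sum_antipode_tmul_mul_comul (a r : H) :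
    ∑ j ∈ (Repr.arbitrary k r).index,
      (antipode k ((Repr.arbitrary k r).left j) ⊗ₜ[k] antipode k a) *
        comul (R := k) ((Repr.arbitrary k r).right j) = 1 ⊗ₜ[k] (antipode k a * r) := by
  -- The map `b ⊗ (c ⊗ d) ↦ S(b) c ⊗ S(a) d`.
  let F : H ⊗[k] (H ⊗[k] H) →ₗ[k] H ⊗[k] H :=
    TensorProduct.lift (LinearMap.compl₂ (LinearMap.mul k (H ⊗[k] H) ∘ₗ
      (TensorProduct.mk k H H).flip (antipode k a) ∘ₗ antipode k) LinearMap.id)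
  have hF : ∀ b x, F (b ⊗ₜ x) = (antipode k b ⊗ₜ[k] antipode k a) * x := fun b x => rfl
  have key := congrArg F (sum_tmul_tmul_eq (Repr.arbitrary k r)
    (fun i => Repr.arbitrary k ((Repr.arbitrary k r).left i))
    (fun i => Repr.arbitrary k ((Repr.arbitrary k r).right i)))
  simp only [map_sum, hF, Algebra.TensorProduct.tmul_mul_tmul] at key
  calc _ = _ := Finset.sum_congr rfl fun j _ => by
        rw [← (Repr.arbitrary k ((Repr.arbitrary k r).right j)).eq, Finset.mul_sum]
        simp only [Algebra.TensorProduct.tmul_mul_tmul]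
    _ = _ := key.symm
    _ = ∑ i ∈ (Repr.arbitrary k r).index, (counit (R := k) ((Repr.arbitrary k r).left i) • (1 : H))
          ⊗ₜ[k] (antipode k a * (Repr.arbitrary k r).right i) := by
        refine Finset.sum_congr rfl fun i _ => ?_
        rw [← TensorProduct.sum_tmul, sum_antipode_mul_eq_smul]
    _ = _ := by
        simp only [TensorProduct.smul_tmul, ← mul_smul_comm]
        rw [← TensorProduct.tmul_sum, ← Finset.mul_sum, sum_counit_smul]

/-- The antipode is an anti-homomorphism of coalgebras, `Δ(S h) = S h₂ ⊗ S h₁`: both sides are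
convolution inverse to `Δ`. -/
theorem comul_antipode (h : H) : comul (R := k) (antipode k h) =
    TensorProduct.map (antipode k) (antipode k) (TensorProduct.comm k H H (comul h)) := by
  have key : WithConv.toConv (TensorProduct.map (antipode k) (antipode k) ∘ₗ
      (TensorProduct.comm k H H).toLinearMap ∘ₗ comul) * WithConv.toConv (comul (R := k) (A := H)) =
      1 := by
    ext c
    rw [(Repr.arbitrary k c).convMul_apply]
    let F : H ⊗[k] (H ⊗[k] H) →ₗ[k] H ⊗[k] H :=
      TensorProduct.lift <| TensorProduct.uncurry (RingHom.id k) H H (H ⊗[k] H) ∘ₗ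
        (LinearMap.mk₂ k (fun a b => LinearMap.mulLeft k (antipode k b ⊗ₜ[k] antipode k a) ∘ₗ comul)
          (fun _ _ _ => by ext; simp [TensorProduct.tmul_add, add_mul])
          (fun _ _ _ => by ext; simp)
          (fun _ _ _ => by ext; simp [TensorProduct.add_tmul, add_mul])
          (fun _ _ _ => by ext; simp [← TensorProduct.smul_tmul']))
    have hF : ∀ a b c, F (a ⊗ₜ (b ⊗ₜ c)) = (antipode k b ⊗ₜ[k] antipode k a) * comul c :=
      fun _ _ _ => rfl
    have e := congrArg F (sum_tmul_tmul_eq (Repr.arbitrary k c)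
      (fun i => Repr.arbitrary k ((Repr.arbitrary k c).left i))
      (fun i => Repr.arbitrary k ((Repr.arbitrary k c).right i)))
    simp only [map_sum, hF, sum_antipode_tmul_mul_comul] at e
    rw [← TensorProduct.tmul_sum, sum_antipode_mul_eq_smul] at e
    calc _ = _ := Finset.sum_congr rfl fun i _ => by
          change TensorProduct.map _ _ (TensorProduct.comm k H H (comul _)) * _ = _
          rw [← (Repr.arbitrary k ((Repr.arbitrary k c).left i)).eq, map_sum, map_sum,
            Finset.sum_mul]
          rfl
      _ = _ := e
      _ = _ := by
        simp [Algebra.TensorProduct.one_def, Algebra.algebraMap_eq_smul_one]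
  have := left_inv_eq_right_inv key LinearMap.comul_right_inv
  exact (LinearMap.congr_fun (WithConv.toConv_injective this) h).symm

variable [BijectiveAntipode k H]

theorem antipode_antipodeInv (h : H) : antipode k (antipodeInv k H h) = h :=
  (LinearEquiv.ofBijective (antipode k : H →ₗ[k] H) BijectiveAntipode.bijective).apply_symm_apply h

theorem antipodeInv_antipode (h : H) : antipodeInv k H (antipode k h) = h :=
  (LinearEquiv.ofBijective (antipode k : H →ₗ[k] H) BijectiveAntipode.bijective).symm_apply_apply h

theorem counit_antipodeInv (h : H) :
    counit (R := k) (antipodeInv k H h) = counit (R := k) h := by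
  rw [← counit_antipode (R := k), antipode_antipodeInv]

theorem comul_antipodeInv (h : H) : comul (R := k) (antipodeInv k H h) =
    TensorProduct.map (antipodeInv k H) (antipodeInv k H)
      (TensorProduct.comm k H H (comul h)) := by
  have e := comul_antipode (k := k) (antipodeInv k H h)
  rw [antipode_antipodeInv] at e
  have hid : antipodeInv k H ∘ₗ antipode k = LinearMap.id := LinearMap.ext antipodeInv_antipode
  rw [e, ← TensorProduct.map_comm, ← LinearMap.comp_apply (TensorProduct.map _ _),
    ← TensorProduct.map_comp, hid, TensorProduct.map_id, LinearMap.id_apply]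
  exact ((TensorProduct.comm k H H).symm_apply_apply _).symm

end HopfAlgebraIdentities
/-! ### The twist by a coaction -/

section Twist

variable {k : Type u} [Field k] {H : Type v} [Ring H] [HopfAlgebra k H] [BijectiveAntipode k H]
variable {M : Type w} [AddCommGroup M] [Module k M]
variable {V : Type*} [AddCommGroup V] [Module k V] {α : H →ₐ[k] Module.End k V}

variable (M) in
/-- The map `h ⊗ m ↦ m ⊗ S⁻¹(h) v`, which sends the coaction of `m` to the twist of `m ⊗ v`. -/
def twistBy (α : H →ₐ[k] Module.End k V) (v : V) :
    H ⊗[k] M →ₗ[k] M ⊗[k] V :=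
  LinearMap.lTensor M (α.toLinearMap.flip v ∘ₗ antipodeInv k H) ∘ₗ
    (TensorProduct.comm k H M).toLinearMap

@[simp]
theorem twistBy_tmul (m : M) (v : V) (h : H) :
    twistBy M α v (h ⊗ₜ m) = m ⊗ₜ[k] α (antipodeInv k H h) v := rfl

end Twist

/-! ### Naturality of the twist and of the diagonal right action -/

section Naturality

variable {k : Type u} [Field k] {H : Type v} [Ring H] [HopfAlgebra k H]
variable {M : Type w} [AddCommGroup M] [Module k M] [Module Hᵐᵒᵖ M] [IsScalarTower k Hᵐᵒᵖ M]
variable {V W U : Type*} [AddCommGroup V] [Module k V] [AddCommGroup W] [Module k W]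
  [AddCommGroup U] [Module k U]
  {α : H →ₐ[k] Module.End k V} {β : H →ₐ[k] Module.End k W} {γ : H →ₐ[k] Module.End k U}

theorem rightTensAct_naturality (F : V →ₗ[k] W) (hF : ∀ h v, F (α h v) = β h (F v)) (h : H)
    (x : M ⊗[k] V) : LinearMap.lTensor M F (rightTensAct M α h x) =
      rightTensAct M β h (LinearMap.lTensor M F x) := by
  suffices ∀ t : H ⊗[k] H, LinearMap.lTensor M F (tensEnd k M V
      (TensorProduct.map (rightAct k H M) (α.toLinearMap ∘ₗ HopfAlgebra.antipode k) t) x) =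
      tensEnd k M W (TensorProduct.map (rightAct k H M) (β.toLinearMap ∘ₗ HopfAlgebra.antipode k) t)
        (LinearMap.lTensor M F x) from this _
  intro t
  induction t with
  | zero => simp
  | add a b ha hb => simp only [map_add, LinearMap.add_apply, ha, hb]
  | tmul a b =>
    induction x with
    | zero => simp
    | add x y hx hy => simp only [map_add, hx, hy]
    | tmul m v =>
      change LinearMap.lTensor M F (rightAct k H M a m ⊗ₜ[k] α (HopfAlgebra.antipode k b) v) =
        rightAct k H M a m ⊗ₜ[k] β (HopfAlgebra.antipode k b) (F v)
      rw [LinearMap.lTensor_tmul, hF]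

variable [BijectiveAntipode k H] [SAYD k H M]

theorem coactTwist_tmul (m : M) (v : V) :
    coactTwist M α (m ⊗ₜ[k] v) = twistBy M α v (SAYD.coact (k := k) (H := H) m) := by
  change (TensorProduct.lift _ (SAYD.coact (k := k) (H := H) m) : V →ₗ[k] M ⊗[k] V) v = _
  induction SAYD.coact (k := k) (H := H) m with
  | zero => simp
  | add a b ha hb => simp only [map_add, LinearMap.add_apply, ha, hb]
  | tmul h m => rfl

theorem coactTwist_naturality (F : V →ₗ[k] W) (hF : ∀ h v, F (α h v) = β h (F v))
    (m : M) (v : V) : coactTwist M β (m ⊗ₜ[k] F v) =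
      LinearMap.lTensor M F (coactTwist M α (m ⊗ₜ[k] v)) := by
  rw [coactTwist_tmul, coactTwist_tmul]
  induction SAYD.coact (k := k) (H := H) m with
  | zero => simp
  | add a b ha hb => simp only [map_add, ha, hb]
  | tmul h m => simp [hF]

theorem coactTwist_of_invariant {v : V} (hv : ∀ h, α h v = Coalgebra.counit (R := k) h • v)
    (m : M) : coactTwist M α (m ⊗ₜ[k] v) = m ⊗ₜ[k] v := by
  rw [coactTwist_tmul]
  conv_rhs => rw [← SAYD.counit (k := k) (H := H) m]
  induction SAYD.coact (k := k) (H := H) m with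
  | zero => simp
  | add a b ha hb => simp only [map_add, ha, hb, TensorProduct.add_tmul]
  | tmul h m => simp [hv, counit_antipodeInv, TensorProduct.smul_tmul]

variable (M α) in
/-- For a bilinear product `P` of `V` and `W`, the map `m ⊗ w ↦ m₍₀₎ ⊗ P (S⁻¹(m₍₋₁₎) v) w`. -/
def twistFirst (P : V →ₗ[k] W →ₗ[k] U) (v : V) : M ⊗[k] W →ₗ[k] M ⊗[k] U :=
  TensorProduct.lift ((LinearMap.lTensorHom M ∘ₗ P.flip).flip ∘ₗ coactTwist M α ∘ₗ
    (TensorProduct.mk k M V).flip v)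

theorem twistFirst_tmul (P : V →ₗ[k] W →ₗ[k] U) (v : V) (m : M) (w : W) :
    twistFirst M α P v (m ⊗ₜ[k] w) =
      LinearMap.lTensor M (P.flip w) (coactTwist M α (m ⊗ₜ[k] v)) := rfl

/-- The twist of a product: `m₍₀₎ ⊗ S⁻¹(m₍₋₁₎)(v w)` is obtained by twisting first by `w` and then
by `v`. This is where coassociativity of the coaction and the anti-comultiplicativity of `S⁻¹`
enter. -/
theorem coactTwist_product (P : V →ₗ[k] W →ₗ[k] U)
    (hP : ∀ h v w, γ h (P v w) = ∑ i ∈ (Coalgebra.Repr.arbitrary k h).index,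
      P (α ((Coalgebra.Repr.arbitrary k h).left i) v)
        (β ((Coalgebra.Repr.arbitrary k h).right i) w))
    (m : M) (v : V) (w : W) :
    coactTwist M γ (m ⊗ₜ[k] P v w) = twistFirst M α P v (coactTwist M β (m ⊗ₜ[k] w)) := by
  -- `a ⊗ b ↦ P (a v) (b w)`
  let Q : H ⊗[k] H →ₗ[k] U := TensorProduct.lift
    (P.compl₁₂ (α.toLinearMap.flip v) (β.toLinearMap.flip w))
  have hQ : ∀ h, γ h (P v w) = Q (Coalgebra.comul h) := fun h => by
    rw [hP, ← (Coalgebra.Repr.arbitrary k h).eq, map_sum]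
    rfl
  -- `a ⊗ (b ⊗ m) ↦ m ⊗ P (S⁻¹(b) v) (S⁻¹(a) w)`
  let G : H ⊗[k] (H ⊗[k] M) →ₗ[k] M ⊗[k] U :=
    (TensorProduct.comm k U M).toLinearMap ∘ₗ
    LinearMap.rTensor M (Q ∘ₗ (TensorProduct.map (antipodeInv k H) (antipodeInv k H)) ∘ₗ
      (TensorProduct.comm k H H).toLinearMap) ∘ₗ (TensorProduct.assoc k H H M).symm.toLinearMap
  have hG : ∀ h x, G (h ⊗ₜ x) =
      LinearMap.lTensor M (P.flip (β (antipodeInv k H h) w)) (twistBy M α v x) := fun h x => by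
    induction x with
    | zero => simp
    | add a b ha hb => simp only [TensorProduct.tmul_add, map_add, ha, hb]
    | tmul b m => rfl
  have h₁ : twistFirst M α P v ∘ₗ twistBy M β w = G ∘ₗ LinearMap.lTensor H (SAYD.coact (k := k) (H := H)) :=
    TensorProduct.ext' fun h m => by
      simp [twistFirst_tmul, hG, coactTwist_tmul]
  have h₂ : twistBy M γ (P v w) = G ∘ₗ (TensorProduct.assoc k H H M).toLinearMap ∘ₗ
      LinearMap.rTensor M Coalgebra.comul :=
    TensorProduct.ext' fun h m => by
      rw [twistBy_tmul, hQ, comul_antipodeInv]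
      simp [G]
  rw [coactTwist_tmul, coactTwist_tmul, ← LinearMap.comp_apply (f := twistFirst M α P v), h₁, h₂]
  simp only [LinearMap.comp_apply, LinearEquiv.coe_coe, SAYD.coassoc]

end Naturality

/-! ### Elementary operations on strings -/

section Paths

variable {k : Type u} [Field k] {D : Type u} [SmallCategory D] [Preadditive D] [Linear k D]

theorem compMap_apply {X Y Z : D} (g : Y ⟶ Z) (f : X ⟶ Y) : compMap k X Y Z g f = f ≫ g := rfl

theorem prepend_append {n : ℕ} {X W Y Z : D} (f : Y ⟶ Z) (p : paths k n W Y) (g : X ⟶ W) :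
    prepend k (n + 1) f (append p g) = append (prepend k n f p) g := by
  simp [prepend]

theorem composeFirst_append {n : ℕ} {X W Y Z : D} (f : Y ⟶ Z) (p : paths k n W Y) (g : X ⟶ W) :
    composeFirst k (n + 1) f (append p g) = append (composeFirst k n f p) g := by
  simp [composeFirst]

theorem composeLast_append {n : ℕ} {X W V Y : D} (p : paths k n V Y) (f : W ⟶ V) (g : X ⟶ W) :
    composeLast k (n + 1) (append p f) g = append p (g ≫ f) := by
  simp [composeLast, compMap_apply]

theorem innerFace_self_append {n : ℕ} {X W Y : D} (p : paths k n W Y) (g : X ⟶ W) :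
    innerFace k n n (append p g) = composeLast k n p g := by
  cases n <;> simp [innerFace]

theorem innerFace_append_of_le {n i : ℕ} (hi : i ≤ n) {X W Y : D} (p : paths k (n + 1) W Y)
    (g : X ⟶ W) : innerFace k (n + 1) i (append p g) = append (innerFace k n i p) g := by
  simp [innerFace, show i ≠ n + 1 by omega]

variable (k) in
/-- The alternating sum `∑ (-1)ⁱ f⁰ ⊗ ⋯ ⊗ fⁱ fⁱ⁺¹ ⊗ ⋯ ⊗ fⁿ⁺¹` over `0 ≤ i ≤ n`, that is, the
Hochschild boundary without its cyclic face. -/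
def innerBoundary (n : ℕ) (X Y : D) : paths k (n + 1) X Y →ₗ[k] paths k n X Y :=
  ∑ i ∈ Finset.range (n + 1), (-1 : k) ^ i • innerFace k n i

theorem innerBoundary_zero_append {X W Y : D} (p : paths k 0 W Y) (g : X ⟶ W) :
    innerBoundary k 0 X Y (append p g) = compMap k X W Y p g := by
  simp [innerBoundary, innerFace_self_append, composeLast]
  rfl

theorem innerBoundary_append {n : ℕ} {X W V Y : D} (p : paths k n V Y) (f : W ⟶ V) (g : X ⟶ W) :
    innerBoundary k (n + 1) X Y (append (append p f) g) =
      append (innerBoundary k n W Y (append p f)) g + (-1 : k) ^ (n + 1) • append p (g ≫ f) := by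
  rw [innerBoundary, Finset.sum_range_succ, LinearMap.add_apply, LinearMap.smul_apply,
    innerFace_self_append, composeLast_append, innerBoundary]
  congr 1
  simp only [LinearMap.sum_apply, LinearMap.smul_apply, map_sum, map_smul]
  refine Finset.sum_congr rfl fun i hi => ?_
  rw [innerFace_append_of_le (Nat.lt_succ_iff.mp (Finset.mem_range.mp hi))]

open scoped Classical in
theorem toModule_ofLoop {n : ℕ} {N : Type*} [AddCommGroup N] [Module k N]
    (F : ∀ X : D, paths k n X X →ₗ[k] N) {X : D} (p : paths k n X X) :
    DirectSum.toModule k D N F (ofLoop k n X p) = F X p :=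
  DirectSum.toModule_lof (M := fun X : D => paths k n X X) k X p

open scoped Classical in
theorem CN_hom_ext {n : ℕ} {M : Type*} [AddCommGroup M] [Module k M] {N : Type*} [AddCommGroup N]
    [Module k N] {φ ψ : M ⊗[k] CN k D n →ₗ[k] N}
    (h : ∀ (X : D) (m : M) (p : paths k n X X),
      φ (m ⊗ₜ ofLoop k n X p) = ψ (m ⊗ₜ ofLoop k n X p)) : φ = ψ := by
  refine TensorProduct.ext (LinearMap.ext fun m => ?_)
  exact DirectSum.linearMap_ext (R := k) fun X => LinearMap.ext fun p => h X m p

variable {H : Type v} [Ring H] [HopfAlgebra k H] [HCategory k H D]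

theorem stringsAct_append {B : D → D → ModuleCat.{u} k}
    (αB : ∀ X Y, H →ₐ[k] Module.End k (B X Y)) {n : ℕ} {X W Y : D} (h : H)
    (p : strings k B n W Y) (f : X ⟶ W) :
    stringsAct αB (n + 1) X Y h (append p f) = ∑ i ∈ (Coalgebra.Repr.arbitrary k h).index,
      append (stringsAct αB n W Y ((Coalgebra.Repr.arbitrary k h).left i) p)
        (HCategory.act (k := k) X W ((Coalgebra.Repr.arbitrary k h).right i) f) := by
  classical
  change DirectSum.lmap (fun W => tensAct (stringsAct αB n W Y) (HCategory.act X W) h)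
    (DirectSum.lof k D (fun W : D => strings k B n W Y ⊗[k] (X ⟶ W)) W (p ⊗ₜ[k] f)) = _
  rw [DirectSum.lmap_lof, tensAct_tmul, map_sum]
  rfl

variable (k H) in
/-- The diagonal action of `H` on `paths k n X Y`. -/
def pathsAct (n : ℕ) (X Y : D) : H →ₐ[k] Module.End k (paths k n X Y) :=
  stringsAct (B := homBase k) HCategory.act n X Y

theorem pathsAct_append {n : ℕ} {X W Y : D} (h : H) (p : paths k n W Y) (f : X ⟶ W) :
    pathsAct k H (n + 1) X Y h (append p f) = ∑ i ∈ (Coalgebra.Repr.arbitrary k h).index,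
      append (pathsAct k H n W Y ((Coalgebra.Repr.arbitrary k h).left i) p)
        (HCategory.act (k := k) X W ((Coalgebra.Repr.arbitrary k h).right i) f) :=
  stringsAct_append _ h p f

theorem loopAct_ofLoop {n : ℕ} {X : D} (h : H) (p : paths k n X X) :
    loopAct k H n h (ofLoop k n X p) = ofLoop k n X (pathsAct k H n X X h p) := by
  classical
  change DirectSum.lmap (fun X => pathsAct k H n X X h)
    (DirectSum.lof k D (fun X : D => paths k n X X) X p) = _
  rw [DirectSum.lmap_lof]
  rfl

end Paths

/-! ### Hopf-cyclic cocycles, evaluated on loops -/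

section Cocycles

variable {k : Type u} [Field k] {H : Type v} [Ring H] [HopfAlgebra k H]
variable {D : Type u} [SmallCategory D] [Preadditive D] [Linear k D] [HCategory k H D]
variable {M : Type w} [AddCommGroup M] [Module k M] [Module Hᵐᵒᵖ M] [IsScalarTower k Hᵐᵒᵖ M]

theorem mem_cochains {n : ℕ} {φ : M ⊗[k] CN k D n →ₗ[k] k} :
    φ ∈ cochains k D H M n ↔ ∀ (h : H) (X : D) (m : M) (p : paths k n X X),
      φ (LinearMap.lTensor M (ofLoop k n X)
        (rightTensAct M (pathsAct k H n X X) h (m ⊗ₜ[k] p))) =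
      Coalgebra.counit (R := k) h * φ (m ⊗ₜ[k] ofLoop k n X p) := by
  simp only [cochains, Submodule.mem_iInf, LinearMap.mem_ker, LinearMap.sub_apply, sub_eq_zero]
  refine forall_congr' fun h => ?_
  have key : ∀ (X : D) (m : M) (p : paths k n X X),
      LinearMap.lTensor M (ofLoop k n X)
        (rightTensAct M (pathsAct k H n X X) h (m ⊗ₜ[k] p)) =
      rightTensAct M (loopAct k H n) h (m ⊗ₜ[k] ofLoop k n X p) := fun X m p => by
    rw [rightTensAct_naturality (β := loopAct k (D := D) H n) (ofLoop k n X)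
      fun h v => (loopAct_ofLoop h v).symm, LinearMap.lTensor_tmul]
  simp only [key]
  exact ⟨fun e X m p => LinearMap.congr_fun e (m ⊗ₜ[k] ofLoop k n X p), fun e => CN_hom_ext e⟩

variable [BijectiveAntipode k H] [SAYD k H M]

theorem rotate_append {n : ℕ} {N : Type*} [AddCommGroup N] [Module k N]
    (β : ∀ X W : D, (X ⟶ W) →ₗ[k] paths k n W X →ₗ[k] N) {X W : D} (m : M) (p : paths k n W X)
    (f : X ⟶ W) : rotate k H M β (m ⊗ₜ[k] ofLoop k (n + 1) X (append p f)) =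
      LinearMap.lTensor M ((β X W).flip p) (coactTwist M (HCategory.act (H := H) X W) (m ⊗ₜ[k] f)) := by
  simp only [rotate, TensorProduct.lift.tmul, LinearMap.flip_apply, toModule_ofLoop,
    liftAppend_append]
  rfl

theorem hopfCyc_append {n : ℕ} {X W : D} (m : M) (p : paths k n W X) (f : X ⟶ W) :
    hopfCyc k H M (n + 1) (m ⊗ₜ[k] ofLoop k (n + 1) X (append p f)) =
      LinearMap.lTensor M (ofLoop k (n + 1) W ∘ₗ (prepend k n).flip p)
        (coactTwist M (HCategory.act (H := H) X W) (m ⊗ₜ[k] f)) :=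
  rotate_append _ m p f

theorem hopfCyc_zero {X : D} (m : M) (f : X ⟶ X) :
    hopfCyc k H M 0 (m ⊗ₜ[k] ofLoop k 0 X f) =
      LinearMap.lTensor M (ofLoop k 0 X) (coactTwist M (HCategory.act (H := H) X X) (m ⊗ₜ[k] f)) :=
  coactTwist_naturality (ofLoop k 0 X) (fun h v => (loopAct_ofLoop h v).symm) m f

theorem sum_hopfFace_append {n : ℕ} {X W : D} (m : M) (p : paths k n W X) (f : X ⟶ W)
    (φ : M ⊗[k] CN k D n →ₗ[k] k) :
    (∑ i ∈ Finset.range (n + 2), (-1 : k) ^ i • LinearMap.lcomp k k (hopfFace k H M n i)) φ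
      (m ⊗ₜ[k] ofLoop k (n + 1) X (append p f)) =
    φ (m ⊗ₜ[k] ofLoop k n X (innerBoundary k n X X (append p f))) + (-1 : k) ^ (n + 1) *
      φ (LinearMap.lTensor M (ofLoop k n W ∘ₗ (composeFirst k n).flip p)
        (coactTwist M (HCategory.act (H := H) X W) (m ⊗ₜ[k] f))) := by
  classical
  rw [Finset.sum_range_succ, LinearMap.add_apply, LinearMap.add_apply]
  congr 1
  · simp only [innerBoundary, LinearMap.sum_apply, map_sum, TensorProduct.tmul_sum]
    refine Finset.sum_congr rfl fun i hi => ?_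
    have : hopfFace k H M n i (m ⊗ₜ[k] ofLoop k (n + 1) X (append p f)) =
        m ⊗ₜ[k] ofLoop k n X (innerFace k n i (append p f)) := by
      rw [hopfFace, if_pos (Nat.lt_succ_iff.mp (Finset.mem_range.mp hi)), LinearMap.lTensor_tmul,
        ofLoop, DirectSum.lmap_lof]
      rfl
    simp [LinearMap.lcomp_apply, this]
  · have : hopfFace k H M n (n + 1) (m ⊗ₜ[k] ofLoop k (n + 1) X (append p f)) =
        LinearMap.lTensor M (ofLoop k n W ∘ₗ (composeFirst k n).flip p)
          (coactTwist M (HCategory.act (H := H) X W) (m ⊗ₜ[k] f)) := by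
      rw [hopfFace, if_neg (by omega), rotate_append]
      rfl
    simp [LinearMap.lcomp_apply, this]

/-- The conditions on a Hopf-cyclic cocycle, evaluated on the generators of `M ⊗ CN_n`. -/
theorem mem_hopfCyclicCocycles {n : ℕ} {φ : M ⊗[k] CN k D n →ₗ[k] k} :
    φ ∈ hopfCyclicCocycles k D H M n ↔ φ ∈ cochains k D H M n ∧
      (∀ (X W : D) (m : M) (p : paths k n W X) (f : X ⟶ W),
        φ (m ⊗ₜ[k] ofLoop k n X (innerBoundary k n X X (append p f))) = (-1 : k) ^ n *
          φ (LinearMap.lTensor M (ofLoop k n W ∘ₗ (composeFirst k n).flip p)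
            (coactTwist M (HCategory.act (H := H) X W) (m ⊗ₜ[k] f)))) ∧
      ∀ (X : D) (m : M) (p : paths k n X X), φ (m ⊗ₜ[k] ofLoop k n X p) =
        (-1 : k) ^ n * φ (hopfCyc k H M n (m ⊗ₜ[k] ofLoop k n X p)) := by
  rw [hopfCyclicCocycles, Submodule.mem_inf, Submodule.mem_inf, and_assoc]
  refine and_congr Iff.rfl (and_congr ?_ ?_)
  · rw [LinearMap.mem_ker]
    have key := fun (X W : D) m p f => sum_hopfFace_append (H := H) (M := M) (X := X) (W := W) m p f φ
    constructor
    · intro e X W m p f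
      have := key X W m p f
      rw [e, LinearMap.zero_apply] at this
      rw [eq_neg_of_add_eq_zero_left this.symm]
      ring
    · intro e
      refine CN_hom_ext fun X m p => ?_
      induction p using strings_induction with
      | zero => simp
      | add x y hx hy => simp only [map_add, TensorProduct.tmul_add, hx, hy]
      | app W p f =>
        rw [key, e, LinearMap.zero_apply]
        ring
  · rw [LinearMap.mem_ker, LinearMap.sub_apply, sub_eq_zero]
    exact ⟨fun e X m p => LinearMap.congr_fun e (m ⊗ₜ[k] ofLoop k n X p), fun e => CN_hom_ext e⟩

end Cocycles

/-! ### The forms defined by a semifunctor -/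

section Forms

variable {k : Type u} [Field k] {D : Type u} [SmallCategory D] [Preadditive D] [Linear k D]

namespace ZeroSemifunctor

variable {S : DGSemicat k} (ρ : ZeroSemifunctor D S)

theorem form_append {n : ℕ} {X W Y : D} (p : paths k n W Y) (g : X ⟶ W) :
    ρ.form (n + 1) (append p g) = S.comp rfl (ρ.form n p) (S.d (zero_add 1) (ρ.map g)) := by
  simp [form]

theorem form_composeFirst : ∀ (n : ℕ) {X Y Z : D} (f : Y ⟶ Z) (p : paths k n X Y),
    ρ.form n (composeFirst k n f p) = S.comp (zero_add n) (ρ.map f) (ρ.form n p)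
  | 0, _, _, _, f, p => ρ.map_comp f p
  | n + 1, X, Y, Z, f, p => by
    induction p using strings_induction with
    | zero => simp
    | add x y hx hy => simp only [map_add, hx, hy]
    | app W p g =>
      rw [composeFirst_append, form_append, form_append, form_composeFirst n,
        S.assoc (zero_add n) rfl]

theorem d_form_append {n : ℕ} {X W Y : D} (p : paths k n W Y) (g : X ⟶ W) :
    S.d (rfl : n + 1 + 1 = _) (ρ.form (n + 1) (append p g)) =
      S.comp rfl (S.d rfl (ρ.form n p)) (S.d (zero_add 1) (ρ.map g)) := by
  rw [form_append, S.leibniz rfl rfl rfl rfl rfl rfl, S.d_d (zero_add 1), map_zero, smul_zero,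
    add_zero]

theorem form_prepend : ∀ (n : ℕ) {X Y Z : D} (f : Y ⟶ Z) (p : paths k n X Y),
    ρ.form (n + 1) (prepend k n f p) =
      S.comp (zero_add (n + 1)) (ρ.map f) (S.d rfl (ρ.form n p))
  | 0, _, _, _, f, p => ρ.form_append (n := 0) f p
  | n + 1, X, Y, Z, f, p => by
    induction p using strings_induction with
    | zero => simp
    | add x y hx hy => simp only [map_add, hx, hy]
    | app W p g =>
      rw [prepend_append, form_append, d_form_append, form_prepend n,
        S.assoc (zero_add (n + 1)) rfl]

/-- The alternating sum of the inner faces is the telescoped form of right multiplication: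
`ρ(f⁰) ∂ρ(f¹) ⋯ ∂ρ(fⁿ) · ρ(g)`, expanded with `(∂f) g = ∂(f g) - f ∂g`. -/
theorem form_innerBoundary : ∀ (n : ℕ) {X W Y : D} (p : paths k n W Y) (g : X ⟶ W),
    ρ.form n (innerBoundary k n X Y (append p g)) =
      (-1 : k) ^ n • S.comp (add_zero n) (ρ.form n p) (ρ.map g)
  | 0, _, _, _, p, g => by
    rw [innerBoundary_zero_append, pow_zero, one_smul]
    exact ρ.map_comp p g
  | n + 1, X, W, Y, p, g => by
    induction p using strings_induction with
    | zero => simp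
    | add x y hx hy => simp only [map_add, LinearMap.add_apply, hx, hy, smul_add]
    | app V p f =>
      have e : S.d (zero_add 1) (ρ.map (g ≫ f)) =
          S.comp (add_zero 1) (S.d (zero_add 1) (ρ.map f)) (ρ.map g) +
            S.comp (zero_add 1) (ρ.map f) (S.d (zero_add 1) (ρ.map g)) := by
        rw [ρ.map_comp, S.leibniz (zero_add 0) (zero_add 1) (zero_add 1) (zero_add 1)
          (add_zero 1) (zero_add 1), pow_zero, one_smul]
      rw [innerBoundary_append, map_add, map_smul, form_append, form_append, form_append,
        form_innerBoundary n, e, map_add, S.assoc rfl (add_zero 1) (add_zero (n + 1)) rfl, map_smul,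
        LinearMap.smul_apply, S.assoc (add_zero n) (zero_add 1) rfl rfl, smul_add, pow_succ]
      simp

end ZeroSemifunctor

variable {H : Type v} [Ring H] [HopfAlgebra k H] [HCategory k H D]

theorem ZeroHSemifunctor.form_act {S : DGHSemicat k H} (ρ : ZeroHSemifunctor D S) :
    ∀ (n : ℕ) {X Y : D} (h : H) (p : paths k n X Y),
      ρ.form n (pathsAct k H n X Y h p) = S.act n _ _ h (ρ.form n p)
  | 0, _, _, h, p => ρ.map_act h p
  | n + 1, X, Y, h, p => by
    induction p using strings_induction with
    | zero => simp
    | add x y hx hy => simp only [map_add, hx, hy]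
    | app W p g =>
      rw [ZeroSemifunctor.form_append, S.act_comp, tensAct_tmul, map_sum, pathsAct_append,
        map_sum]
      refine Finset.sum_congr rfl fun i _ => ?_
      rw [ZeroSemifunctor.form_append, TensorProduct.lift.tmul, ρ.map_act, S.act_d]
      rw [form_act ρ n]

end Forms

/-! ### Characters of cycles are cocycles -/

section Characters

variable {k : Type u} [Field k] {H : Type v} [Ring H] [HopfAlgebra k H] [BijectiveAntipode k H]
variable {D : Type u} [SmallCategory D] [Preadditive D] [Linear k D] [HCategory k H D]
variable {M : Type w} [AddCommGroup M] [Module k M] [Module Hᵐᵒᵖ M] [IsScalarTower k Hᵐᵒᵖ M]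
variable [SAYD k H M] {S : DGHSemicat k H} {n : ℕ}

namespace ClosedGradedHTrace

theorem character_ofLoop (T : ClosedGradedHTrace S M n) (ρ : ZeroHSemifunctor D S) {X : D}
    (m : M) (p : paths k n X X) :
    T.character ρ (m ⊗ₜ[k] ofLoop k n X p) = T.T (ρ.obj X) (m ⊗ₜ[k] ρ.form n p) := by
  simp only [character, TensorProduct.lift.tmul, LinearMap.flip_apply, toModule_ofLoop]
  rfl

theorem character_lTensor (T : ClosedGradedHTrace S M n) (ρ : ZeroHSemifunctor D S) {X : D}
    {V : Type*} [AddCommGroup V] [Module k V] (F : V →ₗ[k] paths k n X X) (x : M ⊗[k] V) :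
    T.character ρ (LinearMap.lTensor M (ofLoop k n X ∘ₗ F) x) =
      T.T (ρ.obj X) (LinearMap.lTensor M (ρ.form n ∘ₗ F) x) := by
  induction x with
  | zero => simp
  | add x y hx hy => simp only [map_add, hx, hy]
  | tmul m v => exact T.character_ofLoop ρ m (F v)

/-- Integration by parts: a closed trace satisfies `T(∂(g) ω) = -(-1)^{|g|} T(g ∂ω)`. -/
theorem d_comp_eq (T : ClosedGradedHTrace S M n) {i j i' j' : ℕ} (hi : i + 1 = i')
    (hj : j + 1 = j') (h₁ : i' + j = n) (h₂ : i + j' = n) {X Y : S.Obj} (m : M)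
    (g : S.Hom i X Y) (ω : S.Hom j Y X) :
    T.T Y (m ⊗ₜ[k] S.comp h₁ (S.d hi g) ω) =
      -(-1 : k) ^ i * T.T Y (m ⊗ₜ[k] S.comp h₂ g (S.d hj ω)) := by
  have e := T.closed (p := i + j) (by omega) Y m (S.comp rfl g ω)
  rw [S.leibniz rfl hi hj (by omega) h₁ h₂, TensorProduct.tmul_add, TensorProduct.tmul_smul,
    map_add, map_smul, smul_eq_mul] at e
  rw [eq_neg_of_add_eq_zero_left e]
  ring

/-- The character of a cycle is a Hopf-cyclic cocycle. The Hochschild condition is the trace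
property for a factor of degree zero, cyclicity the trace property for the factor `∂ρ(fⁿ)`
together with closedness. -/
theorem character_mem (T : ClosedGradedHTrace S M n) (hS : S.ZeroIsHCategory)
    (ρ : ZeroHSemifunctor D S) : T.character ρ ∈ hopfCyclicCocycles k D H M n := by
  refine mem_hopfCyclicCocycles.mpr ⟨mem_cochains.mpr fun h X m p => ?_, fun X W m p f => ?_,
    fun X m p => ?_⟩
  · have e := T.character_lTensor ρ LinearMap.id
      (rightTensAct M (pathsAct k H n X X) h (m ⊗ₜ[k] p))
    rw [LinearMap.comp_id, LinearMap.comp_id] at e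
    rw [e, rightTensAct_naturality (β := S.act n _ _) (ρ.form n) (fun h v => ρ.form_act n h v),
      LinearMap.lTensor_tmul, T.invariant, character_ofLoop]
  · rw [character_ofLoop, character_lTensor, ρ.form_innerBoundary, TensorProduct.tmul_smul,
      map_smul, smul_eq_mul, T.trace (add_zero n) (zero_add n), zero_mul, pow_zero, one_mul,
      coactTwist_naturality (β := S.act 0 _ _) ρ.map (fun h v => ρ.map_act h v),
      ← LinearMap.comp_apply (LinearMap.lTensor M _), ← LinearMap.lTensor_comp]
    congr 4
    exact LinearMap.ext fun f => (ρ.form_composeFirst n f p).symm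
  · obtain _ | n := n
    · -- In degree zero, the trace property is applied to `ρ(f) = e ρ(f)`, with `e` the identity.
      change X ⟶ X at p
      obtain ⟨e, he, he', -⟩ := hS (ρ.obj X)
      have key := T.trace (zero_add 0) (zero_add 0) _ _ m (ρ.map p) e
      rw [he', zero_mul, pow_zero, one_mul,
        coactTwist_naturality (β := S.act 0 _ _) ρ.map (fun h v => ρ.map_act h v),
        ← LinearMap.comp_apply (LinearMap.lTensor M _), ← LinearMap.lTensor_comp] at key
      rw [pow_zero, one_mul]
      refine ((T.character_ofLoop ρ m p).trans key).trans (Eq.trans ?_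
        ((T.character_lTensor ρ LinearMap.id
          (coactTwist M (HCategory.act (H := H) X X) (m ⊗ₜ[k] p))).symm.trans
            (congrArg _ (hopfCyc_zero m p).symm)))
      congr 3
      exact LinearMap.ext fun f => he _ (ρ.map f)
    · induction p using strings_induction with
      | zero => simp
      | add x y hx hy => simp only [map_add, TensorProduct.tmul_add, hx, hy, mul_add]
      | app W p f =>
        have e : coactTwist M (S.act 1 _ _) (m ⊗ₜ[k] S.d (zero_add 1) (ρ.map f)) =
            LinearMap.lTensor M (S.d (zero_add 1) ∘ₗ ρ.map)
              (coactTwist M (HCategory.act (H := H) X W) (m ⊗ₜ[k] f)) :=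
          coactTwist_naturality (S.d (zero_add 1) ∘ₗ ρ.map)
            (fun h v => (congrArg _ (ρ.map_act h v)).trans (S.act_d _ h _)) m f
        rw [character_ofLoop, hopfCyc_append, character_lTensor, ρ.form_append,
          T.trace rfl (add_comm 1 n), one_mul, e]
        induction coactTwist M (HCategory.act (H := H) X W) (m ⊗ₜ[k] f) with
        | zero => simp
        | add x y hx hy => simp only [map_add, mul_add, hx, hy]
        | tmul m f =>
          change (-1 : k) ^ n * T.T _ (m ⊗ₜ[k] S.comp _ (S.d _ (ρ.map f)) (ρ.form n p)) =
            (-1 : k) ^ (n + 1) * T.T _ (m ⊗ₜ[k] ρ.form (n + 1) (prepend k n f p))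
          rw [T.d_comp_eq (zero_add 1) rfl _ (zero_add (n + 1)), ρ.form_prepend]
          ring

end ClosedGradedHTrace

end Characters

/-! ### Forms on the universal DG-semicategory -/

section UniversalForms

variable {k : Type u} [Field k] {D : Type u} [SmallCategory D] [Preadditive D] [Linear k D]

theorem pathForm_append {n : ℕ} {X W Y : D} (p : paths k n W Y) (g : X ⟶ W) :
    pathForm (n + 1) (append p g) = append (pathForm n p) g := by
  simp [pathForm]

theorem omegaIncl_form : ∀ (n : ℕ) {X Y : D} (p : paths k n X Y),
    (omegaIncl k D).form n p = pathForm n p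
  | 0, _, _, _ => rfl
  | n + 1, X, Y, p => by
    induction p using strings_induction with
    | zero => rw [map_zero, map_zero]; rfl
    | add x y hx hy => rw [map_add, map_add, hx, hy]; rfl
    | app W p g =>
      rw [ZeroSemifunctor.form_append, omegaIncl_form n, pathForm_append]
      change formsComp k rfl (pathForm n p) (formsD k 0 (formsInl k X W g)) = _
      rw [formsD_inl, formsComp_append, formsComp_one]

theorem formsComp_inl_pathForm {n : ℕ} {X Y Z : D} (h : 0 + n = n) (f : Y ⟶ Z)
    (p : paths k n X Y) :
    formsComp k h (formsInl k Y Z f) (pathForm n p) = pathForm n (composeFirst k n f p) := by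
  rw [← omegaIncl_form, ← omegaIncl_form, ZeroSemifunctor.form_composeFirst]
  rfl

theorem formsComp_inl_d_pathForm {n : ℕ} {X Y Z : D} (h : 0 + (n + 1) = n + 1) (f : Y ⟶ Z)
    (p : paths k n X Y) :
    formsComp k h (formsInl k Y Z f) (formsD k n (pathForm n p)) =
      pathForm (n + 1) (prepend k n f p) := by
  rw [← omegaIncl_form, ← omegaIncl_form, ZeroSemifunctor.form_prepend]
  rfl

theorem formsMulHom_pathForm {n : ℕ} {X W Y : D} (p : paths k n W Y) (g : X ⟶ W) :
    formsMulHom k n (pathForm n p) g =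
      (-1 : k) ^ n • pathForm n (innerBoundary k n X Y (append p g)) := by
  have e : pathForm n (innerBoundary k n X Y (append p g)) =
      (-1 : k) ^ n • formsMulHom k n (pathForm n p) g := by
    rw [← formsComp_inl (add_zero n), ← omegaIncl_form, ← omegaIncl_form]
    exact ZeroSemifunctor.form_innerBoundary _ n p g
  rw [e, smul_smul, ← mul_pow, neg_one_mul, neg_neg, one_pow, one_smul]

/-- A form of positive degree is the sum of a form `f⁰ df¹ ⋯ dfⁿ⁺¹` and of an exact form
`df⁰ ⋯ dfⁿ`. -/
theorem exists_eq_pathForm_add_formsD : ∀ {n : ℕ} {X Y : D} (ω : forms k (n + 1) X Y),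
    ∃ (p : paths k (n + 1) X Y) (q : paths k n X Y),
      ω = pathForm (n + 1) p + formsD k n (pathForm n q)
  | 0, X, Y, ω => by
    induction ω using strings_induction with
    | zero => exact ⟨0, 0, by simp⟩
    | add x y hx hy =>
      obtain ⟨p, q, rfl⟩ := hx
      obtain ⟨p', q', rfl⟩ := hy
      exact ⟨p + p', q + q', by simp only [map_add]; abel⟩
    | app W ω g =>
      induction ω using formsZero_induction with
      | add x y hx hy =>
        obtain ⟨p, q, hx⟩ := hx
        obtain ⟨p', q', hy⟩ := hy
        exact ⟨p + p', q + q', by simp only [map_add, LinearMap.add_apply, hx, hy]; abel⟩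
      | smul c x hx =>
        obtain ⟨p, q, hx⟩ := hx
        exact ⟨c • p, c • q, by simp only [map_smul, LinearMap.smul_apply, hx, smul_add]⟩
      | inl f =>
        refine ⟨append (B := homBase k) (n := 0) f g, 0, ?_⟩
        rw [map_zero, map_zero, add_zero]
        exact (pathForm_append (n := 0) f g).symm
      | unit h =>
        cases h
        refine ⟨0, g, ?_⟩
        simp only [map_zero, zero_add]
        exact (formsD_inl g).symm
  | n + 1, X, Y, ω => by
    induction ω using strings_induction with
    | zero => exact ⟨0, 0, by simp⟩
    | add x y hx hy =>
      obtain ⟨p, q, rfl⟩ := hx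
      obtain ⟨p', q', rfl⟩ := hy
      exact ⟨p + p', q + q', by simp only [map_add]; abel⟩
    | app W ω g =>
      obtain ⟨p, q, rfl⟩ := exists_eq_pathForm_add_formsD ω
      exact ⟨append p g, append q g, by simp [pathForm_append]⟩

/-- The projection `(f⁰ + μ) df¹ ⋯ dfⁿ ↦ f⁰ ⊗ ⋯ ⊗ fⁿ`, a retraction of `pathForm`. -/
def formsProj : ∀ (n : ℕ) {X Y : D}, forms k n X Y →ₗ[k] paths k n X Y
  | 0, X, Y => LinearMap.fst k (X ⟶ Y) (PLift (X = Y) →₀ k)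
  | n + 1, _, _ => liftAppend fun _ => append ∘ₗ formsProj n

theorem formsProj_append {n : ℕ} {X W Y : D} (ω : forms k n W Y) (g : X ⟶ W) :
    formsProj (n + 1) (append ω g) = append (formsProj n ω) g := by
  simp [formsProj]

theorem formsProj_unit {X Y : D} (h : X = Y) : formsProj 0 (formsUnit k h) = 0 := rfl

theorem formsProj_pathForm : ∀ (n : ℕ) {X Y : D} (p : paths k n X Y),
    formsProj n (pathForm n p) = p
  | 0, _, _, _ => rfl
  | n + 1, X, Y, p => by
    induction p using strings_induction with
    | zero => simp
    | add x y hx hy => simp only [map_add, hx, hy]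
    | app W p g => rw [pathForm_append, formsProj_append, formsProj_pathForm n]

theorem formsProj_formsD : ∀ (n : ℕ) {X Y : D} (ω : forms k n X Y),
    formsProj (n + 1) (formsD k n ω) = 0
  | 0, X, Y, ω => by
    induction ω using formsZero_induction with
    | add x y hx hy => simp only [map_add, hx, hy, add_zero]
    | smul c x hx => simp only [map_smul, hx, smul_zero]
    | inl f => rw [formsD_inl, formsProj_append, formsOne, formsProj_unit, map_zero,
        LinearMap.zero_apply]
    | unit h => rw [formsD_unit, map_zero]
  | n + 1, X, Y, ω => by
    induction ω using strings_induction with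
    | zero => simp
    | add x y hx hy => simp only [map_add, hx, hy, add_zero]
    | app W ω g => rw [formsD_append, formsProj_append, formsProj_formsD n, map_zero,
        LinearMap.zero_apply]

/-- The differential does not see the adjoined identities. -/
theorem formsD_pathForm_formsProj : ∀ (n : ℕ) {X Y : D} (ω : forms k n X Y),
    formsD k n (pathForm n (formsProj n ω)) = formsD k n ω
  | 0, X, Y, ω => by
    induction ω using formsZero_induction with
    | add x y hx hy => simp only [map_add, hx, hy]
    | smul c x hx => simp only [map_smul, hx]
    | inl f => rfl
    | unit h => rw [formsProj_unit, map_zero, map_zero, formsD_unit]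
  | n + 1, X, Y, ω => by
    induction ω using strings_induction with
    | zero => simp
    | add x y hx hy => simp only [map_add, hx, hy]
    | app W ω g => rw [formsProj_append, pathForm_append, formsD_append, formsD_append,
        formsD_pathForm_formsProj n]

theorem formsOne_comp : ∀ (n : ℕ) (h : 0 + n = n) {X Y : D} (ω : forms k n X Y),
    formsComp k h (formsOne k Y) ω = ω
  | 0, _, X, Y, ω => by
    induction ω using formsZero_induction with
    | add x y hx hy => simp only [map_add, hx, hy]
    | smul c x hx => simp only [map_smul, hx]
    | inl f => rw [formsComp_inl, formsMulHom_one]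
    | unit h =>
      cases h
      exact formsComp_one _ _
  | n + 1, _, X, Y, ω => by
    induction ω using strings_induction with
    | zero => simp
    | add x y hx hy => simp only [map_add, hx, hy]
    | app W ω g => rw [formsComp_append, formsOne_comp n]

theorem formsComp_d_inl {n : ℕ} {X Y Z : D} (h : 1 + n = n + 1) (f : Y ⟶ Z) (ω : forms k n X Y) :
    formsComp k h (append (formsOne k Z) f) ω =
      formsD k n (formsComp k (zero_add n) (formsInl k Y Z f) ω) -
        formsComp k (zero_add (n + 1)) (formsInl k Y Z f) (formsD k n ω) := by
  rw [formsD_comp (zero_add n) h (zero_add (n + 1)), pow_zero, one_smul, formsD_inl]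
  exact (add_sub_cancel_right _ _).symm

variable {H : Type v} [Ring H] [HopfAlgebra k H] [HCategory k H D]

theorem formsProj_act : ∀ (n : ℕ) {X Y : D} (h : H) (ω : forms k n X Y),
    formsProj n (formsAct k H n X Y h ω) = pathsAct k H n X Y h (formsProj n ω)
  | 0, _, _, _, _ => rfl
  | n + 1, X, Y, h, ω => by
    induction ω using strings_induction with
    | zero => simp
    | add x y hx hy => simp only [map_add, hx, hy]
    | app W ω g =>
      rw [formsAct_append, formsProj_append, pathsAct_append, map_sum]
      simp only [formsProj_append, formsProj_act n]

variable (k H D) in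
/-- The inclusion of `D` in the degree zero part of `Ω D`, as an `H`-linear semifunctor. -/
def omegaHIncl : ZeroHSemifunctor D (OmegaH k H D) where
  toZeroSemifunctor := omegaIncl k D
  map_act h _ _ f := (formsAct_inl h f).symm

theorem omegaH_zeroIsHCategory : (OmegaH k H D).ZeroIsHCategory := fun (X : D) =>
  ⟨formsOne k X, fun _ f => formsComp_one _ f, fun _ f => formsOne_comp 0 _ f,
    fun h => formsAct_unit h rfl⟩

end UniversalForms

/-! ### The trace defined by a cocycle -/

section TraceOfCocycle

variable {k : Type u} [Field k] {H : Type v} [Ring H] [HopfAlgebra k H]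
variable {D : Type u} [SmallCategory D] [Preadditive D] [Linear k D] [HCategory k H D]
variable {M : Type w} [AddCommGroup M] [Module k M]

/-- The functional `m ⊗ (f⁰ + μ) df¹ ⋯ dfⁿ ↦ φ(m ⊗ f⁰ ⊗ ⋯ ⊗ fⁿ)` defined by a cochain `φ`. -/
def formsFunctional {n : ℕ} (φ : M ⊗[k] CN k D n →ₗ[k] k) (X : D) :
    M ⊗[k] forms k n X X →ₗ[k] k :=
  φ ∘ₗ LinearMap.lTensor M (ofLoop k n X ∘ₗ formsProj n)

theorem formsFunctional_tmul {n : ℕ} (φ : M ⊗[k] CN k D n →ₗ[k] k) {X : D} (m : M)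
    (ω : forms k n X X) :
    formsFunctional φ X (m ⊗ₜ[k] ω) = φ (m ⊗ₜ[k] ofLoop k n X (formsProj n ω)) := rfl

theorem formsFunctional_pathForm {n : ℕ} (φ : M ⊗[k] CN k D n →ₗ[k] k) {X : D} (m : M)
    (p : paths k n X X) :
    formsFunctional φ X (m ⊗ₜ[k] pathForm n p) = φ (m ⊗ₜ[k] ofLoop k n X p) := by
  rw [formsFunctional_tmul, formsProj_pathForm]

theorem formsFunctional_formsD {n : ℕ} (φ : M ⊗[k] CN k D (n + 1) →ₗ[k] k) {X : D} (m : M)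
    (ω : forms k n X X) : formsFunctional φ X (m ⊗ₜ[k] formsD k n ω) = 0 := by
  rw [formsFunctional_tmul, formsProj_formsD, map_zero, TensorProduct.tmul_zero, map_zero]

theorem formsFunctional_lTensor {n : ℕ} (φ : M ⊗[k] CN k D n →ₗ[k] k) {X : D}
    {V : Type*} [AddCommGroup V] [Module k V] {F : V →ₗ[k] forms k n X X}
    {G : V →ₗ[k] paths k n X X} (h : ∀ v, F v = pathForm n (G v)) (x : M ⊗[k] V) :
    formsFunctional φ X (LinearMap.lTensor M F x) =
      φ (LinearMap.lTensor M (ofLoop k n X ∘ₗ G) x) := by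
  induction x with
  | zero => simp
  | add x y hx hy => simp only [map_add, hx, hy]
  | tmul m v => rw [LinearMap.lTensor_tmul, h, formsFunctional_pathForm]; rfl

/-- Integration by parts, `φ(df · ω) = -φ(f · dω)`. -/
theorem formsFunctional_d_inl_comp {n : ℕ} (φ : M ⊗[k] CN k D (n + 1) →ₗ[k] k) {X Y : D}
    (h : 1 + n = n + 1) (ω : forms k n Y X) (x : M ⊗[k] (X ⟶ Y)) :
    formsFunctional φ Y (LinearMap.lTensor M
        ((formsComp k h).flip ω ∘ₗ append (formsOne k Y)) x) =
      -formsFunctional φ Y (LinearMap.lTensor M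
        ((formsComp k (zero_add (n + 1))).flip (formsD k n ω) ∘ₗ formsInl k X Y) x) := by
  induction x with
  | zero => simp
  | add x y hx hy => simp only [map_add, hx, hy, neg_add]
  | tmul m f =>
    simp only [LinearMap.lTensor_tmul, LinearMap.comp_apply, LinearMap.flip_apply]
    rw [formsComp_d_inl, TensorProduct.tmul_sub, map_sub, formsFunctional_formsD, zero_sub]

variable [Module Hᵐᵒᵖ M] [IsScalarTower k Hᵐᵒᵖ M] [BijectiveAntipode k H] [SAYD k H M]

variable (H) in
/-- The form `g` satisfies the trace identity
`T(m ⊗ g' g) = (-1)^{|g| |g'|} T(m₍₀₎ ⊗ (S⁻¹(m₍₋₁₎) g) g')` for all `m` and `g'`. -/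
def HasTraceIdentity {n : ℕ} (T : ∀ X : D, M ⊗[k] forms k n X X →ₗ[k] k) {i : ℕ} {X Y : D}
    (g : forms k i X Y) : Prop :=
  ∀ (j : ℕ) (h : j + i = n) (h' : i + j = n) (m : M) (g' : forms k j Y X),
    T X (m ⊗ₜ[k] formsComp k h g' g) = (-1 : k) ^ (i * j) *
      T Y (LinearMap.lTensor M ((formsComp k h').flip g')
        (coactTwist M (formsAct k H i X Y) (m ⊗ₜ[k] g)))

namespace HasTraceIdentity

variable {n : ℕ} {T : ∀ X : D, M ⊗[k] forms k n X X →ₗ[k] k}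

theorem zero {i : ℕ} {X Y : D} : HasTraceIdentity H T (0 : forms k i X Y) := by
  intro j h h' m g'
  simp

theorem add {i : ℕ} {X Y : D} {g₁ g₂ : forms k i X Y} (h₁ : HasTraceIdentity H T g₁)
    (h₂ : HasTraceIdentity H T g₂) : HasTraceIdentity H T (g₁ + g₂) := by
  intro j h h' m g'
  simp only [map_add, TensorProduct.tmul_add, mul_add, h₁ j h h' m g', h₂ j h h' m g']

theorem smul {i : ℕ} {X Y : D} {g : forms k i X Y} (c : k) (hg : HasTraceIdentity H T g) :
    HasTraceIdentity H T (c • g) := by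
  intro j h h' m g'
  simp only [map_smul, TensorProduct.tmul_smul, hg j h h' m g', smul_eq_mul]
  ring

/-- The trace identity passes to products: `g₂` and then `g₁` is moved to the front. -/
theorem comp {i₁ i₂ i : ℕ} (e : i₁ + i₂ = i) {X Y Z : D} {g₁ : forms k i₁ Y Z}
    {g₂ : forms k i₂ X Y} (h₁ : HasTraceIdentity H T g₁) (h₂ : HasTraceIdentity H T g₂) :
    HasTraceIdentity H T (formsComp k e g₁ g₂) := by
  intro j h h' m g'
  have hs : (-1 : k) ^ (i₂ * (j + i₁)) * (-1 : k) ^ (i₁ * (i₂ + j)) = (-1 : k) ^ (i * j) := by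
    rw [← pow_add, ← e, show i₂ * (j + i₁) + i₁ * (i₂ + j) = (i₁ + i₂) * j + 2 * (i₁ * i₂) by ring,
      pow_add, pow_mul _ 2, neg_one_sq, one_pow, mul_one]
  rw [← formsComp_assoc (rfl : j + i₁ = j + i₁) e (by omega) h,
    h₂ _ (by omega : j + i₁ + i₂ = n) (by omega : i₂ + (j + i₁) = n), ← hs, mul_assoc,
    coactTwist_product (β := formsAct k H i₂ X Y) (α := formsAct k H i₁ Y Z) (formsComp k e)
      (fun h => formsAct_comp e h)]
  congr 1
  induction coactTwist M (formsAct k H i₂ X Y) (m ⊗ₜ[k] g₂) with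
  | zero => simp
  | add x y hx hy => simp only [map_add, mul_add, hx, hy]
  | tmul m g₂ =>
    rw [twistFirst_tmul, LinearMap.lTensor_tmul, LinearMap.flip_apply,
      ← formsComp_assoc rfl rfl (by omega : i₂ + j + i₁ = n),
      h₁ _ (by omega : i₂ + j + i₁ = n) (by omega : i₁ + (i₂ + j) = n),
      ← LinearMap.comp_apply (LinearMap.lTensor M ((formsComp k h').flip g')), ← LinearMap.lTensor_comp]
    congr 4
    exact LinearMap.ext fun g₁ => (formsComp_assoc e rfl _ _ g₁ g₂ g').symm

theorem unit {X Y : D} (e : X = Y) : HasTraceIdentity H T (formsUnit k e) := by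
  intro j h h' m g'
  cases e
  obtain rfl : j = n := h
  rw [coactTwist_of_invariant fun h => formsAct_unit h rfl, LinearMap.lTensor_tmul,
    LinearMap.flip_apply, zero_mul, pow_zero, one_mul]
  exact congrArg (fun ω => T X (m ⊗ₜ[k] ω))
    ((formsComp_one (add_zero j) g').trans (formsOne_comp j h' g').symm)

end HasTraceIdentity

variable {n : ℕ} {φ : M ⊗[k] CN k D n →ₗ[k] k}

theorem coactTwist_inl {X Y : D} (m : M) (f : X ⟶ Y) :
    coactTwist M (formsAct k H 0 X Y) (m ⊗ₜ[k] formsInl k X Y f) =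
      LinearMap.lTensor M (formsInl k X Y)
        (coactTwist M (HCategory.act (H := H) X Y) (m ⊗ₜ[k] f)) :=
  coactTwist_naturality (formsInl k X Y) (fun h v => (formsAct_inl h v).symm) m f

theorem coactTwist_d_inl {X Y : D} (m : M) (f : X ⟶ Y) :
    coactTwist M (formsAct k H 1 X Y) (m ⊗ₜ[k] append (formsOne k Y) f) =
      LinearMap.lTensor M (append (formsOne k Y))
        (coactTwist M (HCategory.act (H := H) X Y) (m ⊗ₜ[k] f)) :=
  coactTwist_naturality (append (formsOne k Y)) (fun h v => by
    rw [← formsD_inl, ← formsAct_inl, formsAct_d, formsD_inl]) m f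

/-- For a cyclic cochain, the trace identity for `df`. Both sides only see the part of `g'` in the
image of `pathForm`, where the identity is the invariance under the cyclic operator. -/
theorem hasTraceIdentity_d_inl (hφ : φ ∈ hopfCyclicCocycles k D H M n) {X Y : D} (f : X ⟶ Y) :
    HasTraceIdentity H (formsFunctional φ) (append (formsOne k Y) f) := by
  intro j h h' m g'
  subst h
  obtain ⟨-, -, hcyc⟩ := mem_hopfCyclicCocycles.mp hφ
  rw [coactTwist_d_inl, ← LinearMap.comp_apply (LinearMap.lTensor M _), ← LinearMap.lTensor_comp,
    formsFunctional_d_inl_comp, formsComp_append, formsComp_one, formsFunctional_tmul,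
    formsProj_append, hcyc, hopfCyc_append, ← formsD_pathForm_formsProj,
    formsFunctional_lTensor φ (G := (prepend k j).flip (formsProj j g')) fun f =>
      formsComp_inl_d_pathForm (zero_add (j + 1)) f _]
  ring

/-- For a cyclic cocycle, the trace identity for `f`. Against a form `f⁰ df¹ ⋯ dfⁿ` it is the
Hochschild cocycle condition; against an exact form it follows, by integration by parts, from the
identity for `df`. -/
theorem hasTraceIdentity_inl (hφ : φ ∈ hopfCyclicCocycles k D H M n) {X Y : D} (f : X ⟶ Y) :
    HasTraceIdentity H (formsFunctional φ) (formsInl k X Y f) := by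
  intro j h h' m g'
  obtain rfl : j = n := h
  obtain ⟨-, hb, hcyc⟩ := mem_hopfCyclicCocycles.mp hφ
  rw [zero_mul, pow_zero, one_mul, formsComp_inl, coactTwist_inl,
    ← LinearMap.comp_apply (LinearMap.lTensor M _), ← LinearMap.lTensor_comp]
  have hpath : ∀ p : paths k j Y X,
      formsFunctional φ X (m ⊗ₜ[k] formsMulHom k j (pathForm j p) f) =
      formsFunctional φ Y (LinearMap.lTensor M
        ((formsComp k h').flip (pathForm j p) ∘ₗ formsInl k X Y)
          (coactTwist M (HCategory.act (H := H) X Y) (m ⊗ₜ[k] f))) := fun p => by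
    rw [formsMulHom_pathForm, TensorProduct.tmul_smul, map_smul, formsFunctional_pathForm, hb,
      smul_eq_mul, ← mul_assoc, ← mul_pow, neg_one_mul, neg_neg, one_pow, one_mul,
      formsFunctional_lTensor φ (G := (composeFirst k j).flip p) fun f =>
        formsComp_inl_pathForm h' f _]
  obtain _ | n := j
  · induction g' using formsZero_induction with
    | add x y hx hy =>
      simp only [map_add, LinearMap.add_apply, TensorProduct.tmul_add, LinearMap.add_comp,
        LinearMap.lTensor_add, hx, hy]
    | smul c x hx =>
      simp only [map_smul, LinearMap.smul_apply, TensorProduct.tmul_smul, LinearMap.smul_comp,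
        LinearMap.lTensor_smul, hx]
    | inl g => exact hpath g
    | unit e =>
      cases e
      have e := hcyc X m f
      rw [pow_zero, one_mul, hopfCyc_zero] at e
      exact (congrArg (fun ω => formsFunctional φ X (m ⊗ₜ[k] ω)) (formsMulHom_one f)).trans
        ((formsFunctional_pathForm φ m (n := 0) f).trans (e.trans
          (formsFunctional_lTensor φ (G := LinearMap.id) (fun f => formsComp_one h' (formsInl k X X f)) _).symm))
  · obtain ⟨p, q, rfl⟩ := exists_eq_pathForm_add_formsD g'
    have hd : formsFunctional φ X (m ⊗ₜ[k] formsMulHom k (n + 1) (formsD k n (pathForm n q)) f) =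
        formsFunctional φ Y (LinearMap.lTensor M
          ((formsComp k h').flip (formsD k n (pathForm n q)) ∘ₗ formsInl k X Y)
            (coactTwist M (HCategory.act (H := H) X Y) (m ⊗ₜ[k] f))) := by
      have e := hasTraceIdentity_d_inl hφ f n rfl (add_comm 1 n) m (pathForm n q)
      rw [coactTwist_d_inl, ← LinearMap.comp_apply (LinearMap.lTensor M _),
        ← LinearMap.lTensor_comp, formsFunctional_d_inl_comp, formsComp_append, formsComp_one,
        show (0 + 1) * n = n by ring] at e
      rw [← sub_eq_iff_eq_add.mpr (formsD_mulHom n (pathForm n q) f), TensorProduct.tmul_sub,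
        map_sub, formsFunctional_formsD, zero_sub, TensorProduct.tmul_smul, map_smul, e,
        smul_eq_mul, mul_neg, mul_neg, neg_neg, ← mul_assoc, ← mul_pow, neg_one_mul, neg_neg,
        one_pow, one_mul]
    simp only [map_add, LinearMap.add_apply, TensorProduct.tmul_add, LinearMap.add_comp,
      LinearMap.lTensor_add, hpath p, hd]

/-- The functional of a cyclic cocycle satisfies all trace identities: the forms are generated by
the morphisms `f`, the adjoined identities and the differentials `df`. -/
theorem hasTraceIdentity (hφ : φ ∈ hopfCyclicCocycles k D H M n) :
    ∀ {i : ℕ} {X Y : D} (g : forms k i X Y), HasTraceIdentity H (formsFunctional φ) g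
  | 0, X, Y, g => by
    induction g using formsZero_induction with
    | add x y hx hy => exact hx.add hy
    | smul c x hx => exact hx.smul c
    | inl f => exact hasTraceIdentity_inl hφ f
    | unit e => exact .unit e
  | i + 1, X, Y, g => by
    induction g using strings_induction with
    | zero => exact .zero
    | add x y hx hy => exact hx.add hy
    | app W ω f =>
      have e : append ω f = formsComp k rfl ω (append (formsOne k W) f) := by
        rw [formsComp_append, formsComp_one]
      rw [e]
      exact (hasTraceIdentity hφ ω).comp rfl (hasTraceIdentity_d_inl hφ f)

/-- The closed graded trace on `Ω D` defined by a Hopf-cyclic cocycle. -/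
def traceOfCocycle (hφ : φ ∈ hopfCyclicCocycles k D H M n) :
    ClosedGradedHTrace (OmegaH k H D) M n where
  T X := formsFunctional φ X
  invariant h (X : D) m (ω : forms k n X X) := by
    have e := mem_cochains.mp (mem_hopfCyclicCocycles.mp hφ).1 h X m (formsProj n ω)
    have e' := rightTensAct_naturality (M := M) (β := pathsAct k H n X X) (formsProj n)
      (fun h v => formsProj_act n h v) h (m ⊗ₜ[k] ω)
    rw [LinearMap.lTensor_tmul] at e'
    rw [← e', ← LinearMap.comp_apply (LinearMap.lTensor M _), ← LinearMap.lTensor_comp] at e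
    exact e
  closed := by
    rintro p rfl X m ω
    exact formsFunctional_formsD φ m ω
  trace h h' X Y m g g' := hasTraceIdentity hφ g _ h h' m g'

end TraceOfCocycle

/-! ### The correspondence between traces and cocycles -/

section Correspondence

variable {k : Type u} [Field k] {H : Type v} [Ring H] [HopfAlgebra k H] [BijectiveAntipode k H]
variable {D : Type u} [SmallCategory D] [Preadditive D] [Linear k D] [HCategory k H D]
variable {M : Type w} [AddCommGroup M] [Module k M] [Module Hᵐᵒᵖ M] [IsScalarTower k Hᵐᵒᵖ M]
variable [SAYD k H M] {n : ℕ}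

theorem ClosedGradedHTrace.cochain_ofLoop (T : ClosedGradedHTrace (OmegaH k H D) M n) {X : D}
    (m : M) (p : paths k n X X) :
    T.cochain (m ⊗ₜ[k] ofLoop k n X p) = T.onForms X (m ⊗ₜ[k] pathForm n p) := by
  simp only [cochain, TensorProduct.lift.tmul, LinearMap.flip_apply, toModule_ofLoop]
  rfl

theorem ClosedGradedHTrace.cochain_eq_character (T : ClosedGradedHTrace (OmegaH k H D) M n) :
    T.cochain = T.character (omegaHIncl k D H) :=
  CN_hom_ext fun X m p => by
    rw [cochain_ofLoop, character_ofLoop]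
    exact congrArg (fun ω => T.onForms X (m ⊗ₜ[k] ω)) (omegaIncl_form n p).symm

theorem ClosedGradedHTrace.cochain_mem (T : ClosedGradedHTrace (OmegaH k H D) M n) :
    T.cochain ∈ hopfCyclicCocycles k D H M n := by
  rw [T.cochain_eq_character]
  exact T.character_mem omegaH_zeroIsHCategory _

theorem traceOfCocycle_cochain {φ : M ⊗[k] CN k D n →ₗ[k] k}
    (hφ : φ ∈ hopfCyclicCocycles k D H M n) : (traceOfCocycle hφ).cochain = φ :=
  CN_hom_ext fun X m p => by
    rw [ClosedGradedHTrace.cochain_ofLoop]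
    exact formsFunctional_pathForm φ m p

theorem ClosedGradedHTrace.ext_onForms {T T' : ClosedGradedHTrace (OmegaH k H D) M n}
    (h : ∀ X m ω, T.onForms X (m ⊗ₜ[k] ω) = T'.onForms X (m ⊗ₜ[k] ω)) : T = T' := by
  have e : T.T = T'.T := funext fun X => TensorProduct.ext' fun m ω => h X m ω
  cases T
  cases T'
  cases e
  rfl

theorem ClosedGradedHTrace.onForms_formsD (T : ClosedGradedHTrace (OmegaH k H D) M (n + 1)) {X : D}
    (m : M) (ω : forms k n X X) : T.onForms X (m ⊗ₜ[k] formsD k n ω) = 0 :=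
  T.closed rfl X m ω

theorem ClosedGradedHTrace.cochain_injective :
    Function.Injective fun T : ClosedGradedHTrace (OmegaH k H D) M (n + 1) => T.cochain := by
  refine fun T T' e => ext_onForms fun X m ω => ?_
  obtain ⟨p, q, rfl⟩ := exists_eq_pathForm_add_formsD ω
  simp only [TensorProduct.tmul_add, map_add, onForms_formsD, ← cochain_ofLoop]
  rw [show T.cochain = T'.cochain from e]

theorem ClosedGradedHTrace.cochain_injOn : Set.InjOn
    (fun T : ClosedGradedHTrace (OmegaH k H D) M 0 => T.cochain)
    {T | ∀ (X : D) (m : M), T.onForms X (m ⊗ₜ[k] formsOne k X) = 0} := by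
  refine fun T hT T' hT' e => ext_onForms fun X m ω => ?_
  induction ω using formsZero_induction with
  | add x y hx hy => simp only [TensorProduct.tmul_add, map_add, hx, hy]
  | smul c x hx => simp only [TensorProduct.tmul_smul, map_smul, hx]
  | inl f =>
    exact (T.cochain_ofLoop m f).symm.trans
      ((LinearMap.congr_fun e _).trans (T'.cochain_ofLoop m f))
  | unit h => exact (hT X m).trans (hT' X m).symm

variable (k H D M) in
/-- The three descriptions of Hopf-cyclic cocycles. -/
theorem hopf_tfae (n : ℕ) (φ : M ⊗[k] CN k D n →ₗ[k] k) : List.TFAE [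
    (∃ (S : DGHSemicat.{u} k H) (_ : S.ZeroIsHCategory) (T : ClosedGradedHTrace S M n)
      (ρ : ZeroHSemifunctor D S), φ = T.character ρ),
    (∃ T : ClosedGradedHTrace (OmegaH k H D) M n, φ = T.cochain),
    φ ∈ hopfCyclicCocycles k D H M n] := by
  tfae_have 1 → 3 := fun ⟨S, hS, T, ρ, e⟩ => e ▸ T.character_mem hS ρ
  tfae_have 3 → 2 := fun hφ => ⟨traceOfCocycle hφ, (traceOfCocycle_cochain hφ).symm⟩
  tfae_have 2 → 1 := fun ⟨T, e⟩ => ⟨OmegaH k H D, omegaH_zeroIsHCategory, T, omegaHIncl k D H,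
    e.trans T.cochain_eq_character⟩
  tfae_finish

variable (k H D M) in
theorem hopf_bijOn (n : ℕ) (hn : 1 ≤ n) : Set.BijOn
    (fun T : ClosedGradedHTrace (OmegaH k H D) M n => T.cochain) Set.univ
    (hopfCyclicCocycles k D H M n) := by
  obtain ⟨n, rfl⟩ := Nat.exists_eq_add_of_le' hn
  exact ⟨fun T _ => T.cochain_mem, ClosedGradedHTrace.cochain_injective.injOn,
    fun φ hφ => ⟨traceOfCocycle hφ, trivial, traceOfCocycle_cochain hφ⟩⟩

theorem traceOfCocycle_one {φ : M ⊗[k] CN k D 0 →ₗ[k] k} (hφ : φ ∈ hopfCyclicCocycles k D H M 0)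
    (X : D) (m : M) : (traceOfCocycle hφ).onForms X (m ⊗ₜ[k] formsOne k X) = 0 := by
  refine (formsFunctional_tmul φ m (formsOne k X)).trans ?_
  rw [formsOne, formsProj_unit, map_zero, TensorProduct.tmul_zero, map_zero]

variable (k H D M) in
theorem hopf_bijOn_zero : Set.BijOn
    (fun T : ClosedGradedHTrace (OmegaH k H D) M 0 => T.cochain)
    {T | ∀ (X : D) (m : M), T.onForms X (m ⊗ₜ[k] formsOne k X) = 0}
    (hopfCyclicCocycles k D H M 0) :=
  ⟨fun T _ => T.cochain_mem, ClosedGradedHTrace.cochain_injOn,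
    fun _ hφ => ⟨traceOfCocycle hφ, traceOfCocycle_one hφ, traceOfCocycle_cochain hφ⟩⟩

end Correspondence

/-! ### The ordinary case as the case `H = k = M` -/

section Scalars

variable {k : Type u} [Field k]

theorem algHom_self_apply {V : Type*} [AddCommGroup V] [Module k V] (α : k →ₐ[k] Module.End k V)
    (c : k) (v : V) : α c v = c • v :=
  LinearMap.congr_fun (α.commutes c) v

instance : BijectiveAntipode k k where
  bijective := by
    rw [CommSemiring.antipode_eq_id]
    exact Function.bijective_id

/-- The ground field as a stable anti-Yetter-Drinfeld module over itself, with `m ↦ 1 ⊗ m`. -/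
instance : SAYD k k k where
  coact := TensorProduct.mk k k k 1
  coassoc m := by simp
  counit m := by simp
  ayd m h := by
    rw [CommSemiring.comul_apply, LinearMap.lTensor_tmul, CommSemiring.comul_apply]
    change 1 ⊗ₜ[k] (m * h) = (h * (1 * 1)) ⊗ₜ[k] (m * 1)
    rw [mul_one, mul_one, mul_one, mul_comm m h, ← smul_eq_mul h m, ← TensorProduct.smul_tmul,
      smul_eq_mul, mul_one]
  stable m := by simp [rightAct]

theorem coactTwist_self {V : Type*} [AddCommGroup V] [Module k V] (α : k →ₐ[k] Module.End k V)
    (c : k) (v : V) : coactTwist k α (c ⊗ₜ[k] v) = c ⊗ₜ[k] v :=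
  coactTwist_of_invariant (fun h => algHom_self_apply α h v) c

theorem rightTensAct_self {V : Type*} [AddCommGroup V] [Module k V] (α : k →ₐ[k] Module.End k V)
    (h c : k) (v : V) : rightTensAct k α h (c ⊗ₜ[k] v) = h • (c ⊗ₜ[k] v) := by
  have e : rightTensAct k α h (c ⊗ₜ[k] v) =
      tensEnd k k V (TensorProduct.map (rightAct k k k) (α.toLinearMap ∘ₗ HopfAlgebra.antipode k)
        (Coalgebra.comul h)) (c ⊗ₜ[k] v) := rfl
  rw [e, CommSemiring.comul_apply]
  change (c * 1) ⊗ₜ[k] α h v = _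
  rw [mul_one, algHom_self_apply, TensorProduct.tmul_smul]

variable {C : Type u} [SmallCategory C] [Preadditive C] [Linear k C]

/-- Every `k`-linear category is a left `k`-category. -/
instance : HCategory k k C where
  act X Y := Algebra.ofId k (Module.End k (X ⟶ Y))
  act_id h X := rfl
  act_comp h X Y Z g f := by
    rw [algHom_self_apply, algHom_self_apply, map_smul]
    rfl

/-- A DG-semicategory as a DGH-semicategory for `H = k`. -/
def DGSemicat.scalarAct (S : DGSemicat k) : DGHSemicat k k where
  toDGSemicat := S
  act n X Y := Algebra.ofId k (Module.End k (S.Hom n X Y))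
  act_comp e h X Y Z g f := by
    rw [algHom_self_apply, algHom_self_apply, map_smul]
    rfl
  act_d e h X Y f := by rw [algHom_self_apply, algHom_self_apply, map_smul]

theorem DGSemicat.ZeroIsCategory.scalarAct {S : DGSemicat k} (hS : S.ZeroIsCategory) :
    S.scalarAct.ZeroIsHCategory := fun X =>
  let ⟨e, he, he'⟩ := hS X
  ⟨e, he, he', fun _ => rfl⟩

/-- A semifunctor as a `k`-linear semifunctor. -/
def ZeroSemifunctor.scalarAct {S : DGSemicat k} (ρ : ZeroSemifunctor C S) :
    ZeroHSemifunctor C S.scalarAct where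
  toZeroSemifunctor := ρ
  map_act h _ _ f := ρ.map.map_smul h f

/-- A closed graded trace as a closed graded `(k, k)`-trace. -/
def ClosedGradedTrace.scalarAct {S : DGSemicat k} {n : ℕ} (T : ClosedGradedTrace S n) :
    ClosedGradedHTrace S.scalarAct k n where
  T (X : S.Obj) := T.T X ∘ₗ (TensorProduct.lid k (S.Hom n X X)).toLinearMap
  invariant h X c f := by
    rw [rightTensAct_self, map_smul]
    rfl
  closed {p} hp (X : S.Obj) c (f : S.Hom p X X) := by
    change T.T X (c • S.d hp f) = 0
    rw [map_smul, T.closed, smul_zero]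
  trace {i j} h h' (X : S.Obj) (Y : S.Obj) c (g : S.Hom i X Y) (g' : S.Hom j Y X) := by
    have e : T.T X (c • S.comp h g' g) = (-1 : k) ^ (i * j) * T.T Y (c • S.comp h' g g') := by
      rw [map_smul, map_smul, T.trace h h', smul_eq_mul, smul_eq_mul, mul_left_comm]
    have e' := coactTwist_self (Algebra.ofId k (Module.End k (S.Hom i X Y))) c g
    exact e.trans (congrArg (fun x => (-1 : k) ^ (i * j) * T.T Y (TensorProduct.lid k (S.Hom n Y Y)
      (LinearMap.lTensor k ((S.comp h').flip g') x))) e'.symm)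

/-- A closed graded `(k, k)`-trace on `Ω C` as a closed graded trace. -/
def ClosedGradedHTrace.ordinary {n : ℕ} (T : ClosedGradedHTrace (OmegaH k k C) k n) :
    ClosedGradedTrace (Omega k C) n where
  T (X : C) := (T.onForms X ∘ₗ TensorProduct.mk k k (forms k n X X) 1 : forms k n X X →ₗ[k] k)
  closed {p} hp (X : C) (f : forms k p X X) := T.closed hp X 1 f
  trace {i j} h h' (X : C) (Y : C) (g : forms k i X Y) g' :=
    (T.trace h h' X Y 1 g g').trans (congrArg
      (fun x => (-1 : k) ^ (i * j) * T.onForms Y (LinearMap.lTensor k ((formsComp k h').flip g') x))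
      (coactTwist_self (formsAct k k i X Y) 1 g))

variable (k C) in
/-- The cochain on `k ⊗ CN_n` corresponding to a cochain on `CN_n`. It intertwines the face maps
and the cyclic operators, so that ordinary cocycles become Hopf-cyclic ones. -/
def scalarCochain (n : ℕ) : (CN k C n →ₗ[k] k) →ₗ[k] (k ⊗[k] CN k C n →ₗ[k] k) :=
  LinearMap.lcomp k k (TensorProduct.lid k (CN k C n)).toLinearMap

theorem scalarCochain_tmul {n : ℕ} (φ : CN k C n →ₗ[k] k) (c : k) (x : CN k C n) :
    scalarCochain k C n φ (c ⊗ₜ[k] x) = c * φ x :=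
  φ.map_smul c x

theorem scalarCochain_injective (n : ℕ) : Function.Injective (scalarCochain k C n) :=
  fun φ ψ e => LinearMap.ext fun x => by
    have := LinearMap.congr_fun e (1 ⊗ₜ[k] x)
    rwa [scalarCochain_tmul, scalarCochain_tmul, one_mul, one_mul] at this

theorem CN_hom_ext' {n : ℕ} {φ ψ : CN k C n →ₗ[k] k}
    (h : ∀ (X : C) (p : paths k n X X), φ (ofLoop k n X p) = ψ (ofLoop k n X p)) : φ = ψ := by
  refine scalarCochain_injective n (CN_hom_ext fun X c p => ?_)
  rw [scalarCochain_tmul, scalarCochain_tmul, h]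

theorem hopfFace_self (n i : ℕ) :
    hopfFace k k (D := C) k n i = LinearMap.lTensor k (loopFace k n i) := by
  by_cases hi : i ≤ n
  · simp only [hopfFace, loopFace, if_pos hi]
  · refine CN_hom_ext fun X c p => ?_
    induction p using strings_induction with
    | zero => simp
    | add x y hx hy => simp only [map_add, TensorProduct.tmul_add, hx, hy]
    | app W p f =>
      simp only [hopfFace, loopFace, if_neg hi]
      rw [rotate_append, coactTwist_self, LinearMap.lTensor_tmul, LinearMap.lTensor_tmul,
        toModule_ofLoop, liftAppend_append]

theorem hopfCyc_self : ∀ n : ℕ,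
    hopfCyc k k (D := C) k n = LinearMap.lTensor k (loopCyc k n)
  | 0 => TensorProduct.ext' fun c x => coactTwist_self _ c x
  | n + 1 => by
    refine CN_hom_ext fun X c p => ?_
    induction p using strings_induction with
    | zero => simp
    | add x y hx hy => simp only [map_add, TensorProduct.tmul_add, hx, hy]
    | app W p f =>
      rw [hopfCyc_append, coactTwist_self, LinearMap.lTensor_tmul, LinearMap.lTensor_tmul, loopCyc,
        toModule_ofLoop, liftAppend_append]
      rfl

theorem scalarCochain_comp_lTensor {n m : ℕ} (φ : CN k C n →ₗ[k] k)
    (F : CN k C m →ₗ[k] CN k C n) :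
    LinearMap.lcomp k k (LinearMap.lTensor k F) (scalarCochain k C n φ) =
      scalarCochain k C m (LinearMap.lcomp k k F φ) :=
  TensorProduct.ext' fun c x => by
    change scalarCochain k C n φ (c ⊗ₜ[k] F x) = _
    rw [scalarCochain_tmul, scalarCochain_tmul]
    rfl

theorem scalarCochain_mem {n : ℕ} {φ : CN k C n →ₗ[k] k} :
    scalarCochain k C n φ ∈ hopfCyclicCocycles k C k k n ↔ φ ∈ cyclicCocycles k C n := by
  have hc : scalarCochain k C n φ ∈ cochains k C k k n := mem_cochains.mpr fun h X c p => by
    rw [rightTensAct_self, map_smul, map_smul, LinearMap.lTensor_tmul]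
    rfl
  rw [hopfCyclicCocycles, cyclicCocycles, Submodule.mem_inf, Submodule.mem_inf, Submodule.mem_inf,
    and_iff_right hc]
  simp only [LinearMap.mem_ker, LinearMap.sub_apply, LinearMap.sum_apply, LinearMap.smul_apply,
    hopfFace_self, hopfCyc_self, scalarCochain_comp_lTensor, LinearMap.id_apply,
    ← map_smul (scalarCochain k C _), ← map_sum (scalarCochain k C _),
    ← map_sub (scalarCochain k C _), map_eq_zero_iff _ (scalarCochain_injective _)]

theorem ClosedGradedTrace.character_ofLoop {S : DGSemicat k} {n : ℕ} (T : ClosedGradedTrace S n)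
    (ρ : ZeroSemifunctor C S) {X : C} (p : paths k n X X) :
    T.character ρ (ofLoop k n X p) = T.T (ρ.obj X) (ρ.form n p) := by
  simp only [character, toModule_ofLoop]
  rfl

theorem ClosedGradedTrace.scalarAct_character {S : DGSemicat k} {n : ℕ}
    (T : ClosedGradedTrace S n) (ρ : ZeroSemifunctor C S) :
    T.scalarAct.character ρ.scalarAct = scalarCochain k C n (T.character ρ) :=
  CN_hom_ext fun X c p => by
    rw [ClosedGradedHTrace.character_ofLoop, scalarCochain_tmul, character_ofLoop]
    exact (T.T (ρ.obj X)).map_smul c _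

theorem ClosedGradedTrace.character_mem {S : DGSemicat k} {n : ℕ} (T : ClosedGradedTrace S n)
    (hS : S.ZeroIsCategory) (ρ : ZeroSemifunctor C S) :
    T.character ρ ∈ cyclicCocycles k C n := by
  rw [← scalarCochain_mem, ← scalarAct_character]
  exact T.scalarAct.character_mem hS.scalarAct _

theorem omega_zeroIsCategory : (Omega k C).ZeroIsCategory := fun (X : C) =>
  ⟨formsOne k X, fun _ f => formsComp_one _ f, fun _ f => formsOne_comp 0 _ f⟩

theorem ClosedGradedTrace.cochain_ofLoop {n : ℕ} (T : ClosedGradedTrace (Omega k C) n) {X : C}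
    (p : paths k n X X) : T.cochain (ofLoop k n X p) = T.onForms X (pathForm n p) := by
  simp only [cochain, toModule_ofLoop]
  rfl

theorem ClosedGradedTrace.cochain_eq_character {n : ℕ} (T : ClosedGradedTrace (Omega k C) n) :
    T.cochain = T.character (omegaIncl k C) :=
  CN_hom_ext' fun X p => by
    rw [cochain_ofLoop, character_ofLoop]
    exact congrArg (T.onForms X) (omegaIncl_form n p).symm

theorem ClosedGradedTrace.cochain_mem {n : ℕ} (T : ClosedGradedTrace (Omega k C) n) :
    T.cochain ∈ cyclicCocycles k C n := by
  rw [T.cochain_eq_character]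
  exact T.character_mem omega_zeroIsCategory _

/-- The closed graded trace on `Ω C` defined by a cyclic cocycle. -/
def traceOfCyclicCocycle {n : ℕ} {φ : CN k C n →ₗ[k] k} (hφ : φ ∈ cyclicCocycles k C n) :
    ClosedGradedTrace (Omega k C) n :=
  (traceOfCocycle (scalarCochain_mem.mpr hφ)).ordinary

theorem traceOfCyclicCocycle_cochain {n : ℕ} {φ : CN k C n →ₗ[k] k}
    (hφ : φ ∈ cyclicCocycles k C n) : (traceOfCyclicCocycle hφ).cochain = φ :=
  CN_hom_ext' fun X p => by
    rw [ClosedGradedTrace.cochain_ofLoop]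
    refine (formsFunctional_pathForm (scalarCochain k C n φ) 1 p).trans ?_
    rw [scalarCochain_tmul, one_mul]

theorem traceOfCyclicCocycle_one {φ : CN k C 0 →ₗ[k] k} (hφ : φ ∈ cyclicCocycles k C 0) (X : C) :
    (traceOfCyclicCocycle hφ).onForms X (formsOne k X) = 0 :=
  traceOfCocycle_one (scalarCochain_mem.mpr hφ) X 1

theorem ClosedGradedTrace.ext_onForms {n : ℕ} {T T' : ClosedGradedTrace (Omega k C) n}
    (h : ∀ X ω, T.onForms X ω = T'.onForms X ω) : T = T' := by
  have e : T.T = T'.T := funext fun X => LinearMap.ext fun ω => h X ω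
  cases T
  cases T'
  cases e
  rfl

theorem ClosedGradedTrace.cochain_injective {n : ℕ} :
    Function.Injective fun T : ClosedGradedTrace (Omega k C) (n + 1) => T.cochain := by
  refine fun T T' e => ext_onForms fun X ω => ?_
  have hd : ∀ (T : ClosedGradedTrace (Omega k C) (n + 1)) (ω : forms k n X X),
      T.onForms X (formsD k n ω) = 0 := fun T ω => T.closed rfl X ω
  obtain ⟨p, q, rfl⟩ := exists_eq_pathForm_add_formsD ω
  simp only [map_add, hd, ← cochain_ofLoop]
  rw [show T.cochain = T'.cochain from e]

theorem ClosedGradedTrace.cochain_injOn : Set.InjOn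
    (fun T : ClosedGradedTrace (Omega k C) 0 => T.cochain)
    {T | ∀ X : C, T.onForms X (formsOne k X) = 0} := by
  refine fun T hT T' hT' e => ext_onForms fun X ω => ?_
  induction ω using formsZero_induction with
  | add x y hx hy => simp only [map_add, hx, hy]
  | smul c x hx => simp only [map_smul, hx]
  | inl f =>
    exact (T.cochain_ofLoop f).symm.trans
      ((LinearMap.congr_fun e _).trans (T'.cochain_ofLoop f))
  | unit h => exact (hT X).trans (hT' X).symm

variable (k C) in
/-- The three descriptions of cyclic cocycles. -/
theorem ordinary_tfae (n : ℕ) (φ : CN k C n →ₗ[k] k) : List.TFAE [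
    (∃ (S : DGSemicat.{u} k) (_ : S.ZeroIsCategory) (T : ClosedGradedTrace S n)
      (ρ : ZeroSemifunctor C S), φ = T.character ρ),
    (∃ T : ClosedGradedTrace (Omega k C) n, φ = T.cochain),
    φ ∈ cyclicCocycles k C n] := by
  tfae_have 1 → 3 := fun ⟨S, hS, T, ρ, e⟩ => e ▸ T.character_mem hS ρ
  tfae_have 3 → 2 := fun hφ => ⟨traceOfCyclicCocycle hφ, (traceOfCyclicCocycle_cochain hφ).symm⟩
  tfae_have 2 → 1 := fun ⟨T, e⟩ => ⟨Omega k C, omega_zeroIsCategory, T, omegaIncl k C,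
    e.trans T.cochain_eq_character⟩
  tfae_finish

variable (k C) in
theorem ordinary_bijOn (n : ℕ) (hn : 1 ≤ n) : Set.BijOn
    (fun T : ClosedGradedTrace (Omega k C) n => T.cochain) Set.univ (cyclicCocycles k C n) := by
  obtain ⟨n, rfl⟩ := Nat.exists_eq_add_of_le' hn
  exact ⟨fun T _ => T.cochain_mem, ClosedGradedTrace.cochain_injective.injOn,
    fun φ hφ => ⟨traceOfCyclicCocycle hφ, trivial, traceOfCyclicCocycle_cochain hφ⟩⟩

variable (k C) in
theorem ordinary_bijOn_zero : Set.BijOn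
    (fun T : ClosedGradedTrace (Omega k C) 0 => T.cochain)
    {T | ∀ X : C, T.onForms X (formsOne k X) = 0} (cyclicCocycles k C 0) :=
  ⟨fun T _ => T.cochain_mem, ClosedGradedTrace.cochain_injOn,
    fun _ hφ => ⟨traceOfCyclicCocycle hφ, traceOfCyclicCocycle_one hφ,
      traceOfCyclicCocycle_cochain hφ⟩⟩

end Scalars

end HopfCyclic

end

theorem mainTheorem1 (k : Type u) [Field k] [CharZero k] :
    -- Hopf-cyclic version
    (∀ (H : Type v) [Ring H] [HopfAlgebra k H] [BijectiveAntipode k H]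
      (D : Type u) [SmallCategory D] [Preadditive D] [Linear k D] [HCategory k H D]
      (M : Type w) [AddCommGroup M] [Module k M] [Module Hᵐᵒᵖ M] [IsScalarTower k Hᵐᵒᵖ M]
      [SAYD k H M],
      (∀ (n : ℕ) (φ : M ⊗[k] CN k D n →ₗ[k] k), φ ∈ cochains k D H M n →
        List.TFAE [
          (∃ (S : DGHSemicat.{u} k H) (_ : S.ZeroIsHCategory) (T : ClosedGradedHTrace S M n)
            (ρ : ZeroHSemifunctor D S), φ = T.character ρ),
          (∃ T : ClosedGradedHTrace (OmegaH k H D) M n, φ = T.cochain),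
          φ ∈ hopfCyclicCocycles k D H M n]) ∧
      (∀ n : ℕ, 1 ≤ n → Set.BijOn
        (fun T : ClosedGradedHTrace (OmegaH k H D) M n => T.cochain) Set.univ
        (hopfCyclicCocycles k D H M n)) ∧
      Set.BijOn (fun T : ClosedGradedHTrace (OmegaH k H D) M 0 => T.cochain)
        {T | ∀ (X : D) (m : M), T.onForms X (m ⊗ₜ[k] formsOne k X) = 0}
        (hopfCyclicCocycles k D H M 0)) ∧
    -- ordinary version
    (∀ (C : Type u) [SmallCategory C] [Preadditive C] [Linear k C],
      (∀ (n : ℕ) (φ : CN k C n →ₗ[k] k),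
        List.TFAE [
          (∃ (S : DGSemicat.{u} k) (_ : S.ZeroIsCategory) (T : ClosedGradedTrace S n)
            (ρ : ZeroSemifunctor C S), φ = T.character ρ),
          (∃ T : ClosedGradedTrace (Omega k C) n, φ = T.cochain),
          φ ∈ cyclicCocycles k C n]) ∧
      (∀ n : ℕ, 1 ≤ n → Set.BijOn
        (fun T : ClosedGradedTrace (Omega k C) n => T.cochain) Set.univ
        (cyclicCocycles k C n)) ∧
      Set.BijOn (fun T : ClosedGradedTrace (Omega k C) 0 => T.cochain)
        {T | ∀ X : C, T.onForms X (formsOne k X) = 0}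
        (cyclicCocycles k C 0)) := by
  refine ⟨?_, ?_⟩
  · intro H _ _ _ D _ _ _ _ M _ _ _ _ _
    exact ⟨fun n φ _ => hopf_tfae k H D M n φ, hopf_bijOn k H D M, hopf_bijOn_zero k H D M⟩
  · intro C _ _ _
    exact ⟨ordinary_tfae k C, ordinary_bijOn k C, ordinary_bijOn_zero k C⟩
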